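/- Let $G$ and $Q$ be locally compact (Hausdorff) topological groups. All unitary representations, actions on metric spaces, cocycles and homomorphisms are continuous (a unitary representation $\pi$ on a Hilbert space is continuous if $g\mapsto\pi(g)\xi$ is continuous for every vector $\xi$). A unitary representation $\pi$ of a group $L$ has a $(K,\varepsilon)$-invariant vector, for $K\subset L$, if there is a vector $\xi\neq 0$ with $\|\pi(g)\xi-\xi\|\le\varepsilon\|\xi\|$ for all $g\in K$; it almost has invariant vectors, written $1_L\prec\pi$, if it has a $(K,\varepsilon)$-invariant vector for every compact $K\subset L$ and every $\varepsilon>0$. A net $(\pi_i)$ of unitary representations of $L$ converges to the trivial one-dimensional representation $1_L$ if for all such $K$ and $\varepsilon$, eventually $\pi_i$ has a $(K,\varepsilon)$-invariant vector. Let $f:G\to Q$ be a continuous homomorphism with dense image. For a unitary representation $\pi$ of $G$ on $\mathscr H$, let $\mathscr H^Q$ be the closed subspace of those $\xi$ for which $g\mapsto\pi(g)\xi$ factors as $w\circ f$ with $w:Q\to\mathscr H$ continuous; the restriction of $\pi$ to $\mathscr H^Q$ factors through a unitary representation $\pi^Q$ of $Q$. The morphism $f$ is a resolution if $1_G\prec\pi$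 implies $1_Q\prec\pi^Q$ for every unitary representation $\pi$ of $G$. A unitary representation is finite if its kernel has finite index. Consider the following properties of a topological group $L$. - (T): every unitary representation $\pi$ of $L$ with $1_L\prec\pi$ has a nonzero invariant vector. - $(\tau)$ [resp. $(\tau_{FD})$]: for every net $(\pi_i)$ of finite [resp. finite-dimensional] irreducible unitary representations of $L$ converging to $1_L$, eventually $\pi_i=1_L$ (up to equivalence). - (FAb) [resp. $(\mathrm{FAb}^{\mathbf R})$]: for every closed subgroup $H$ of finite index in $L$, $\mathrm{Hom}(H,\mathbf Z)=0$ [resp. $\mathrm{Hom}(H,\mathbf R)=0$]. - $(\mathrm{FH}_F)$: every finite unitary representation $\pi$ of $L$ has vanishing 1-cohomology, i.e. every continuous map $b$ from $L$ to the space of $\pi$ with $b(gh)=b(g)+\pi(g)b(h)$ has the form $b(g)=\pi(g)v-v$. - $(\mathrm{FH}_{FD})$: every isometric action of $L$ on a finite-dimensional Hilbert space has a fixed point. Proposition. Let $f:G\to Q$ be a resolution. If (P) is one of the properties (T), $(\tau)$, $(\tau_{FD})$, (FAb), $(\mathrm{FAb}^{\mathbf R})$, $(\mathrm{FH}_F)$,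 $(\mathrm{FH}_{FD})$, then $G$ has Property (P) if and only if $Q$ has Property (P). -/

import Mathlib

open Filter Topology

universe u

/-- A unitary representation of a topological group `G` on `H`: a homomorphism to the unitary
group of `H` all of whose orbit maps are continuous. -/
structure UnitaryRep (G : Type*) [Group G] [TopologicalSpace G]
    (H : Type*) [NormedAddCommGroup H] [InnerProductSpace ℂ H] where
  toHom : G →* (H ≃ₗᵢ[ℂ] H)
  continuous_orbit : ∀ ξ : H, Continuous fun g => toHom g ξ

namespace UnitaryRep

section Basic

variable {G : Type*} [Group G] [TopologicalSpace G]
  {H : Type*} [NormedAddCommGroup H] [InnerProductSpace ℂ H]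

/-- `π` has a `(X, ε)`-invariant vector. -/
def HasAlmostInvariantVector (π : UnitaryRep G H) (X : Set G) (ε : ℝ) : Prop :=
  ∃ ξ : H, ξ ≠ 0 ∧ ∀ g ∈ X, ‖π.toHom g ξ - ξ‖ ≤ ε * ‖ξ‖

/-- `1 ≺ π`: the representation `π` almost has invariant vectors. -/
def AlmostHasInvariantVectors (π : UnitaryRep G H) : Prop :=
  ∀ K : Set G, IsCompact K → ∀ ε : ℝ, 0 < ε → π.HasAlmostInvariantVector K ε

/-- `π` has a nonzero invariant vector. -/
def HasInvariantVector (π : UnitaryRep G H) : Prop :=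
  ∃ ξ : H, ξ ≠ 0 ∧ ∀ g : G, π.toHom g ξ = ξ

/-- `π` is irreducible: nonzero, without closed invariant subspaces other than `0` and `H`. -/
def IsIrreducible (π : UnitaryRep G H) : Prop :=
  Nontrivial H ∧ ∀ V : Submodule ℂ H, IsClosed (V : Set H) →
    (∀ g : G, ∀ ξ ∈ V, π.toHom g ξ ∈ V) → V = ⊥ ∨ V = ⊤

/-- `π` is finite: its kernel has finite index. -/
def IsFinite (π : UnitaryRep G H) : Prop :=
  π.toHom.ker.FiniteIndex

/-- `π` is (equivalent to) the trivial one-dimensional representation `1_G`. -/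
def IsTrivialOne (π : UnitaryRep G H) : Prop :=
  Module.finrank ℂ H = 1 ∧ ∀ (g : G) (ξ : H), π.toHom g ξ = ξ

/-- The continuous 1-cohomology of `G` with coefficients in `π` vanishes: every continuous
1-cocycle is a coboundary. -/
def HasVanishingH1 (π : UnitaryRep G H) : Prop :=
  ∀ b : G → H, Continuous b → (∀ g h : G, b (g * h) = b g + π.toHom g (b h)) →
    ∃ v : H, ∀ g : G, b g = π.toHom g v - v

end Basic

/-- A net `(π i)` of unitary representations of `G` converges to `1_G` in the Fell topology:
for every compact `K` and every `ε > 0`, eventually `π i` has a `(K, ε)`-invariant vector. -/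
def TendstoTrivial {G : Type*} [Group G] [TopologicalSpace G] {ι : Type*} [Preorder ι]
    {H : ι → Type*} [∀ i, NormedAddCommGroup (H i)] [∀ i, InnerProductSpace ℂ (H i)]
    (π : ∀ i, UnitaryRep G (H i)) : Prop :=
  ∀ K : Set G, IsCompact K → ∀ ε : ℝ, 0 < ε →
    ∀ᶠ i in atTop, (π i).HasAlmostInvariantVector K ε

section QVectors

variable {G Q : Type*} [Group G] [TopologicalSpace G] [Group Q] [TopologicalSpace Q]
  {H : Type*} [NormedAddCommGroup H] [InnerProductSpace ℂ H]

/-- `w` is a factorization through `f : G → Q` of the orbit map of `ξ`. -/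
def IsOrbitFactor (f : G →ₜ* Q) (π : UnitaryRep G H) (ξ : H) (w : Q → H) : Prop :=
  Continuous w ∧ ∀ g : G, w (f g) = π.toHom g ξ

theorem IsOrbitFactor.unique {f : G →ₜ* Q} (hf : DenseRange f) {π : UnitaryRep G H} {ξ : H}
    {w w' : Q → H} (h : IsOrbitFactor f π ξ w) (h' : IsOrbitFactor f π ξ w') : w = w' :=
  hf.equalizer h.1 h'.1 (funext fun g => (h.2 g).trans (h'.2 g).symm)

theorem IsOrbitFactor.add {f : G →ₜ* Q} {π : UnitaryRep G H} {ξ η : H} {w w' : Q → H}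
    (h : IsOrbitFactor f π ξ w) (h' : IsOrbitFactor f π η w') :
    IsOrbitFactor f π (ξ + η) (fun q => w q + w' q) :=
  ⟨h.1.add h'.1, fun g => by simp [h.2 g, h'.2 g]⟩

theorem IsOrbitFactor.smul {f : G →ₜ* Q} {π : UnitaryRep G H} {ξ : H} {w : Q → H}
    (h : IsOrbitFactor f π ξ w) (c : ℂ) :
    IsOrbitFactor f π (c • ξ) (fun q => c • w q) :=
  ⟨h.1.const_smul c, fun g => by simp [h.2 g]⟩

theorem IsOrbitFactor.map_one {f : G →ₜ* Q} {π : UnitaryRep G H} {ξ : H} {w : Q → H}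
    (h : IsOrbitFactor f π ξ w) : w 1 = ξ := by
  have := h.2 1
  simpa using this

theorem IsOrbitFactor.norm_eq {f : G →ₜ* Q} (hf : DenseRange f) {π : UnitaryRep G H} {ξ : H}
    {w : Q → H} (h : IsOrbitFactor f π ξ w) (q : Q) : ‖w q‖ = ‖ξ‖ := by
  have := hf.equalizer h.1.norm (continuous_const (y := ‖ξ‖))
    (funext fun g => by simp [h.2 g])
  exact congrFun this q

/-- The subspace `H^Q` of `Q`-vectors: those whose orbit map factors through `Q`. -/
def qVectors (f : G →ₜ* Q) (π : UnitaryRep G H) : Submodule ℂ H where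
  carrier := {ξ | ∃ w : Q → H, IsOrbitFactor f π ξ w}
  zero_mem' := ⟨fun _ => 0, continuous_const, fun g => by simp⟩
  add_mem' := fun ⟨_, h⟩ ⟨_, h'⟩ => ⟨_, h.add h'⟩
  smul_mem' := fun c _ ⟨_, h⟩ => ⟨_, h.smul c⟩

/-- The factored orbit map `Q → H` of a `Q`-vector. -/
noncomputable def orbitFactor (f : G →ₜ* Q) (π : UnitaryRep G H) (ξ : qVectors f π) : Q → H :=
  Classical.choose ξ.2

theorem orbitFactor_spec (f : G →ₜ* Q) (π : UnitaryRep G H) (ξ : qVectors f π) :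
    IsOrbitFactor f π (ξ : H) (orbitFactor f π ξ) :=
  Classical.choose_spec ξ.2

theorem orbitFactor_eq {f : G →ₜ* Q} (hf : DenseRange f) {π : UnitaryRep G H}
    {ξ : qVectors f π} {w : Q → H} (h : IsOrbitFactor f π (ξ : H) w) :
    orbitFactor f π ξ = w :=
  (orbitFactor_spec f π ξ).unique hf h

variable [IsTopologicalGroup Q]

/-- The vector `w q` is again a `Q`-vector, with orbit map `q' ↦ w (q' * q)`. -/
theorem IsOrbitFactor.translate {f : G →ₜ* Q} (hf : DenseRange f) {π : UnitaryRep G H} {ξ : H}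
    {w : Q → H} (h : IsOrbitFactor f π ξ w) (q : Q) :
    IsOrbitFactor f π (w q) (fun q' => w (q' * q)) := by
  refine ⟨h.1.comp (continuous_mul_const q), fun g => ?_⟩
  have := hf.equalizer (g := fun x => w (f g * x)) (h := fun x => π.toHom g (w x))
    (h.1.comp (continuous_const_mul (f g))) ((π.toHom g).continuous.comp h.1)
    (funext fun k => by
      simp only [Function.comp_apply]
      rw [← map_mul, h.2, h.2, map_mul]
      rfl)
  exact congrFun this q

/-- The action of `q : Q` on `H^Q`. -/
noncomputable def qAct (f : G →ₜ* Q) (hf : DenseRange f) (π : UnitaryRep G H) (q : Q)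
    (ξ : qVectors f π) : qVectors f π :=
  ⟨orbitFactor f π ξ q, _, (orbitFactor_spec f π ξ).translate hf q⟩

theorem qAct_mul (f : G →ₜ* Q) (hf : DenseRange f) (π : UnitaryRep G H) (q q' : Q)
    (ξ : qVectors f π) : qAct f hf π (q * q') ξ = qAct f hf π q (qAct f hf π q' ξ) :=
  Subtype.ext (congrFun (orbitFactor_eq hf (ξ := qAct f hf π q' ξ)
    ((orbitFactor_spec f π ξ).translate hf q')) q).symm

theorem qAct_one (f : G →ₜ* Q) (hf : DenseRange f) (π : UnitaryRep G H)
    (ξ : qVectors f π) : qAct f hf π 1 ξ = ξ :=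
  Subtype.ext (orbitFactor_spec f π ξ).map_one

/-- The representation `π^Q`, viewed as a unitary representation of `Q` on `H^Q`. -/
noncomputable def qRep (f : G →ₜ* Q) (hf : DenseRange f) (π : UnitaryRep G H) :
    UnitaryRep Q (qVectors f π) where
  toHom :=
    { toFun := fun q =>
        { toFun := qAct f hf π q
          invFun := qAct f hf π q⁻¹
          map_add' := fun ξ η => Subtype.ext (congrFun (orbitFactor_eq hf (ξ := ξ + η)
            ((orbitFactor_spec f π ξ).add (orbitFactor_spec f π η))) q)
          map_smul' := fun c ξ => Subtype.ext (congrFun (orbitFactor_eq hf (ξ := c • ξ)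
            ((orbitFactor_spec f π ξ).smul c)) q)
          left_inv := fun ξ => by rw [← qAct_mul, inv_mul_cancel, qAct_one]
          right_inv := fun ξ => by rw [← qAct_mul, mul_inv_cancel, qAct_one]
          norm_map' := fun ξ => (orbitFactor_spec f π ξ).norm_eq hf q }
      map_one' := LinearIsometryEquiv.ext fun ξ => qAct_one f hf π ξ
      map_mul' := fun q q' => LinearIsometryEquiv.ext fun ξ => qAct_mul f hf π q q' ξ }
  continuous_orbit := fun ξ => (orbitFactor_spec f π ξ).1.subtype_mk _

end QVectors

end UnitaryRep

section Resolution

variable {G Q : Type u} [Group G] [TopologicalSpace G] [Group Q] [TopologicalSpace Q]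
  [IsTopologicalGroup Q]

/-- A morphism `f : G → Q` is a resolution if it has dense image and `1_G ≺ π` implies
`1_Q ≺ π^Q` for every unitary representation `π` of `G` on a Hilbert space. -/
structure IsResolution (f : G →ₜ* Q) : Prop where
  dense : DenseRange f
  almost : ∀ (H : Type u) [NormedAddCommGroup H] [InnerProductSpace ℂ H] [CompleteSpace H]
    (π : UnitaryRep G H), π.AlmostHasInvariantVectors →
      (π.qRep f dense).AlmostHasInvariantVectors

end Resolution

section Properties

variable (G : Type u) [Group G] [TopologicalSpace G]

/-- Kazhdan's Property (T): every unitary representation that almost has invariant vectors has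
a nonzero invariant vector. -/
def PropertyT : Prop :=
  ∀ (H : Type u) [NormedAddCommGroup H] [InnerProductSpace ℂ H] [CompleteSpace H]
    (π : UnitaryRep G H), π.AlmostHasInvariantVectors → π.HasInvariantVector

/-- Property (τ): every net of finite irreducible unitary representations converging to `1_G`
is eventually equal to `1_G`. -/
def PropertyTau : Prop :=
  ∀ (ι : Type u) [Preorder ι] [IsDirectedOrder ι] [Nonempty ι]
    (H : ι → Type u) [∀ i, NormedAddCommGroup (H i)] [∀ i, InnerProductSpace ℂ (H i)]
    [∀ i, CompleteSpace (H i)] (π : ∀ i, UnitaryRep G (H i)),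
    (∀ i, (π i).IsIrreducible) → (∀ i, (π i).IsFinite) →
      UnitaryRep.TendstoTrivial π → ∀ᶠ i in atTop, (π i).IsTrivialOne

/-- Property (τ_FD): every net of finite-dimensional irreducible unitary representations
converging to `1_G` is eventually equal to `1_G`. -/
def PropertyTauFD : Prop :=
  ∀ (ι : Type u) [Preorder ι] [IsDirectedOrder ι] [Nonempty ι]
    (H : ι → Type u) [∀ i, NormedAddCommGroup (H i)] [∀ i, InnerProductSpace ℂ (H i)]
    [∀ i, CompleteSpace (H i)] (π : ∀ i, UnitaryRep G (H i)),
    (∀ i, (π i).IsIrreducible) → (∀ i, FiniteDimensional ℂ (H i)) →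
      UnitaryRep.TendstoTrivial π → ∀ᶠ i in atTop, (π i).IsTrivialOne

/-- Property (FAb): closed subgroups of finite index have no nonzero continuous homomorphism
to `ℤ`. -/
def PropertyFAb : Prop :=
  ∀ H : Subgroup G, IsClosed (H : Set G) → H.FiniteIndex →
    ∀ φ : H →ₜ* Multiplicative ℤ, ∀ h : H, φ h = 1

/-- Property (FAb^ℝ): closed subgroups of finite index have no nonzero continuous homomorphism
to `ℝ`. -/
def PropertyFAbReal : Prop :=
  ∀ H : Subgroup G, IsClosed (H : Set G) → H.FiniteIndex →
    ∀ φ : H →ₜ* Multiplicative ℝ, ∀ h : H, φ h = 1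

/-- Property (FH_F): every finite unitary representation has vanishing 1-cohomology. -/
def PropertyFHF : Prop :=
  ∀ (H : Type u) [NormedAddCommGroup H] [InnerProductSpace ℂ H] [CompleteSpace H]
    (π : UnitaryRep G H), π.IsFinite → π.HasVanishingH1

/-- Property (FH_FD): every continuous isometric action on a finite-dimensional Hilbert space
has a fixed point. Every finite-dimensional complex Hilbert space is in particular a real one,
and every isometry of it is an isometry of the underlying real one. -/
def PropertyFHFD : Prop :=
  ∀ (E : Type u) [NormedAddCommGroup E] [InnerProductSpace ℝ E] [FiniteDimensional ℝ E]
    (α : G →* (E ≃ᵢ E)), (∀ x : E, Continuous fun g => α g x) →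
      ∃ x : E, ∀ g : G, α g x = x

end Properties

/-! From $G$ to $Q$ every property passes by restricting along `f`: density of the image makes
invariance, irreducibility, coboundaries and vanishing of homomorphisms on $f(G)$ spread to $Q$. The
content is the passage from $Q$ to $G$.

For (T) the definition of a resolution suffices, since an invariant vector of $\pi^Q$ is
$G$-invariant. For $(\tau)$ and $(\tau_{FD})$, a family of counterexamples on $G$ is put into one
Hilbert sum. The resolution gives an almost invariant $Q$-vector of the sum, and averaging over a
compact set with Haar measure finds one summand whose $Q$-part is almost invariant
(`exists_almostInvariant_coordinate`). By irreducibility that summand equals its $Q$-part, hence is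
trivial.

The other properties rest on `IsResolution.exists_orbit_extension`. The Koopman representation on
$L^2(E)$ of an isometric action on a Euclidean space $E$ almost has invariant vectors, because large
balls are almost invariant; so it has a nonzero $Q$-vector. As isometries with large translation
part move that vector far, the action is bounded along $f(g)\to 1$, and an asymptotic centre has an
orbit map that extends to $Q$. The points with this property form an affine subspace on which $Q$
acts; this gives $(\mathrm{FH}_{FD})$. For $(\mathrm{FH}_F)$ the result is applied to affine actions
given by cocycles, after reduction to finite-dimensional subrepresentations; for the (FAb)
properties, to the action induced from a homomorphism $H\to\mathbf R$. -/

/-! ### Extending maps along a homomorphism with dense image. -/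

section Extension

variable {G Q X : Type*} [Group G] [TopologicalSpace G] [Group Q] [TopologicalSpace Q]
  [IsTopologicalGroup Q] [MetricSpace X] [CompleteSpace X]

/-- A map `F` on `G` that is uniformly continuous for the left uniformity pulled back along
`f : G → Q` extends to a continuous map on `Q`. -/
theorem exists_continuous_extension (f : G →ₜ* Q) (hf : DenseRange f) (F : G → X)
    (hF : ∀ ε > 0, ∃ W ∈ 𝓝 (1 : Q), ∀ g h : G, (f g)⁻¹ * f h ∈ W → dist (F g) (F h) < ε) :
    ∃ w : Q → X, Continuous w ∧ ∀ g, w (f g) = F g := by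
  -- For the pulled-back topology `f` is dense inducing, so a limit along each `comap f (𝓝 q)` is
  -- all that is needed; the Cauchy property and completeness of `X` provide it.
  let _ : TopologicalSpace G := TopologicalSpace.induced f inferInstance
  have hi : IsDenseInducing (f : G → Q) := ⟨⟨rfl⟩, hf⟩
  have key : ∀ q : Q, ∀ ε > 0, ∃ U ∈ 𝓝 q, ∀ g h : G, f g ∈ U → f h ∈ U →
      dist (F g) (F h) < ε := by
    intro q ε hε
    obtain ⟨W, hW, hW'⟩ := hF ε hε
    have hc : Tendsto (fun p : Q × Q => p.1⁻¹ * p.2) (𝓝 q ×ˢ 𝓝 q) (𝓝 1) := by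
      have : Continuous fun p : Q × Q => p.1⁻¹ * p.2 := by fun_prop
      simpa [nhds_prod_eq] using this.tendsto (q, q)
    obtain ⟨U, hU, hUU⟩ := mem_prod_same_iff.1 (hc hW)
    exact ⟨U, hU, fun g h hg hh => hW' g h (hUU (Set.mk_mem_prod hg hh))⟩
  have hcont : Continuous F := by
    refine continuous_iff_continuousAt.2 fun g => Metric.tendsto_nhds.2 fun ε hε => ?_
    obtain ⟨U, hU, h⟩ := key (f g) ε hε
    filter_upwards [hi.continuous.continuousAt.preimage_mem_nhds hU] with k hk
    exact h k g hk (mem_of_mem_nhds hU)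
  refine ⟨hi.extend F, hi.continuous_extend fun q => ?_, hi.extend_eq hcont⟩
  have hne : (comap f (𝓝 q)).NeBot := hi.comap_nhds_neBot q
  refine CompleteSpace.complete (Metric.cauchy_iff.2 ⟨hne.map _, fun ε hε => ?_⟩)
  obtain ⟨U, hU, h⟩ := key q ε hε
  refine ⟨F '' (f ⁻¹' U), image_mem_map (preimage_mem_comap hU), ?_⟩
  rintro _ ⟨g, hg, rfl⟩ _ ⟨k, hk, rfl⟩
  exact h g k hg hk

/-- The orbit map of a point under an action by isometries extends continuously along `f` as
soon as it is continuous at `1` for the topology pulled back along `f`. -/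
theorem exists_orbit_extension (f : G →ₜ* Q) (hf : DenseRange f) (a : G → X → X)
    (hmul : ∀ g h x, a (g * h) x = a g (a h x)) (hiso : ∀ g x y, dist (a g x) (a g y) = dist x y)
    (x : X) (hx : ∀ ε > 0, ∃ W ∈ 𝓝 (1 : Q), ∀ g : G, f g ∈ W → dist (a g x) x < ε) :
    ∃ w : Q → X, Continuous w ∧ ∀ g, w (f g) = a g x := by
  refine exists_continuous_extension f hf _ fun ε hε => ?_
  obtain ⟨W, hW, h⟩ := hx ε hε
  refine ⟨W, hW, fun g k hgk => ?_⟩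
  have h1 := h (g⁻¹ * k) (by simpa using hgk)
  rwa [← hiso g, ← hmul, mul_inv_cancel_left, dist_comm] at h1

end Extension

theorem finiteIndex_comap {G Q : Type*} [Group G] [Group Q] (f : G →* Q) (H : Subgroup Q)
    [H.FiniteIndex] : (H.comap f).FiniteIndex := by
  rw [Subgroup.finiteIndex_iff, Subgroup.index_comap]
  exact (Subgroup.isFiniteRelIndex_of_finiteIndex (H := H) (K := f.range)).relIndex_ne_zero

namespace UnitaryRep

/-! ### Pulling back representations from $Q$ to $G$. -/

section Pullback

variable {G Q : Type*} [Group G] [TopologicalSpace G] [Group Q] [TopologicalSpace Q]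
  {H : Type*} [NormedAddCommGroup H] [InnerProductSpace ℂ H]

/-- The pullback of a unitary representation along a continuous homomorphism. -/
def pullback (f : G →ₜ* Q) (ρ : UnitaryRep Q H) : UnitaryRep G H where
  toHom := ρ.toHom.comp f.toMonoidHom
  continuous_orbit ξ := (ρ.continuous_orbit ξ).comp f.continuous_toFun

@[simp] theorem pullback_apply (f : G →ₜ* Q) (ρ : UnitaryRep Q H) (g : G) :
    (ρ.pullback f).toHom g = ρ.toHom (f g) := rfl

theorem HasAlmostInvariantVector.pullback {f : G →ₜ* Q} {ρ : UnitaryRep Q H} {K : Set G} {ε : ℝ}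
    (h : ρ.HasAlmostInvariantVector (f '' K) ε) : (ρ.pullback f).HasAlmostInvariantVector K ε := by
  obtain ⟨ξ, h0, h⟩ := h
  exact ⟨ξ, h0, fun g hg => h (f g) (Set.mem_image_of_mem _ hg)⟩

theorem HasAlmostInvariantVector.mono {π : UnitaryRep G H} {K K' : Set G} {ε ε' : ℝ}
    (h : π.HasAlmostInvariantVector K ε) (hK : K' ⊆ K) (hε : ε ≤ ε') :
    π.HasAlmostInvariantVector K' ε' := by
  obtain ⟨ξ, h0, h⟩ := h
  exact ⟨ξ, h0, fun g hg => (h g (hK hg)).trans (by gcongr)⟩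

theorem AlmostHasInvariantVectors.pullback {f : G →ₜ* Q} {ρ : UnitaryRep Q H}
    (h : ρ.AlmostHasInvariantVectors) : (ρ.pullback f).AlmostHasInvariantVectors :=
  fun K hK ε hε => (h (f '' K) (hK.image f.continuous_toFun) ε hε).pullback

theorem eq_of_dense {f : G →ₜ* Q} (hf : DenseRange f) (ρ : UnitaryRep Q H) {ξ η : H}
    (h : ∀ g, ρ.toHom (f g) ξ = η) (q : Q) : ρ.toHom q ξ = η :=
  congrFun (hf.equalizer (ρ.continuous_orbit ξ) continuous_const (funext h)) q

theorem IsIrreducible.pullback {f : G →ₜ* Q} (hf : DenseRange f) {ρ : UnitaryRep Q H}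
    (h : ρ.IsIrreducible) : (ρ.pullback f).IsIrreducible := by
  refine ⟨h.1, fun V hV hinv => h.2 V hV fun q ξ hξ => ?_⟩
  have : IsClosed {q | ρ.toHom q ξ ∈ V} := hV.preimage (ρ.continuous_orbit ξ)
  have hsub : Set.range f ⊆ {q | ρ.toHom q ξ ∈ V} := by
    rintro _ ⟨g, rfl⟩
    exact hinv g ξ hξ
  exact this.closure_subset_iff.2 hsub (hf q)

theorem IsFinite.pullback (f : G →ₜ* Q) {ρ : UnitaryRep Q H} (h : ρ.IsFinite) :
    (ρ.pullback f).IsFinite := by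
  have : ρ.toHom.ker.FiniteIndex := h
  change (ρ.toHom.comp f.toMonoidHom).ker.FiniteIndex
  rw [← MonoidHom.comap_ker]
  exact finiteIndex_comap _ _

theorem IsTrivialOne.of_pullback {f : G →ₜ* Q} (hf : DenseRange f) {ρ : UnitaryRep Q H}
    (h : (ρ.pullback f).IsTrivialOne) : ρ.IsTrivialOne :=
  ⟨h.1, fun q ξ => ρ.eq_of_dense hf (fun g => h.2 g ξ) q⟩

theorem HasInvariantVector.of_pullback {f : G →ₜ* Q} (hf : DenseRange f) {ρ : UnitaryRep Q H}
    (h : (ρ.pullback f).HasInvariantVector) : ρ.HasInvariantVector := by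
  obtain ⟨ξ, h0, h⟩ := h
  exact ⟨ξ, h0, ρ.eq_of_dense hf h⟩

theorem HasVanishingH1.of_pullback {f : G →ₜ* Q} (hf : DenseRange f) {ρ : UnitaryRep Q H}
    (h : (ρ.pullback f).HasVanishingH1) : ρ.HasVanishingH1 := by
  intro b hb hcoc
  obtain ⟨v, hv⟩ := h (b ∘ f) (hb.comp f.continuous_toFun) fun g k => by simp [hcoc]
  refine ⟨v, fun q => ?_⟩
  exact congrFun (hf.equalizer hb ((ρ.continuous_orbit v).sub continuous_const)
    (funext fun g => hv g)) q

end Pullback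

/-! ### The $Q$-part of a representation of $G$. -/

section QRep

variable {G Q : Type*} [Group G] [TopologicalSpace G] [Group Q] [TopologicalSpace Q]
  [IsTopologicalGroup Q] {H : Type*} [NormedAddCommGroup H] [InnerProductSpace ℂ H]

theorem qRep_map_coe (f : G →ₜ* Q) (hf : DenseRange f) (π : UnitaryRep G H) (g : G)
    (ξ : qVectors f π) : (((π.qRep f hf).toHom (f g) ξ : qVectors f π) : H) = π.toHom g ξ :=
  (orbitFactor_spec f π ξ).2 g

theorem map_mem_qVectors (f : G →ₜ* Q) (hf : DenseRange f) (π : UnitaryRep G H) (g : G)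
    {ξ : H} (hξ : ξ ∈ qVectors f π) : π.toHom g ξ ∈ qVectors f π := by
  rw [← qRep_map_coe f hf π g ⟨ξ, hξ⟩]
  exact Subtype.coe_prop _

/-- Since the action is isometric, it suffices that the orbit map of a limit be continuous at `1`
for the pulled-back topology, which follows by comparison with a nearby $Q$-vector. -/
theorem isClosed_qVectors [CompleteSpace H] (f : G →ₜ* Q) (hf : DenseRange f)
    (π : UnitaryRep G H) : IsClosed (qVectors f π : Set H) := by
  refine isClosed_of_closure_subset fun ξ hξ => ?_
  refine exists_orbit_extension f hf (fun g => π.toHom g) (fun g h x => by simp)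
    (fun g x y => (π.toHom g).dist_map x y) ξ fun ε hε => ?_
  obtain ⟨η, ⟨w, hw⟩, hη⟩ := Metric.mem_closure_iff.1 hξ (ε / 3) (by positivity)
  refine ⟨w ⁻¹' Metric.ball η (ε / 3),
    hw.1.continuousAt.preimage_mem_nhds ?_, fun g hg => ?_⟩
  · rw [hw.map_one]
    exact Metric.ball_mem_nhds _ (by positivity)
  · have h1 : dist (π.toHom g η) η < ε / 3 := by
      rw [← hw.2 g]
      exact hg
    have h2 : dist (π.toHom g ξ) (π.toHom g η) < ε / 3 := by
      rwa [(π.toHom g).dist_map]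
    have h3 := dist_triangle4 (π.toHom g ξ) (π.toHom g η) η ξ
    rw [dist_comm η ξ] at h3
    linarith

theorem IsIrreducible.qVectors_eq_top [CompleteSpace H] {f : G →ₜ* Q} (hf : DenseRange f)
    {π : UnitaryRep G H} (h : π.IsIrreducible) (hne : Nontrivial (qVectors f π)) :
    qVectors f π = ⊤ :=
  (h.2 _ (isClosed_qVectors f hf π) fun g _ => map_mem_qVectors f hf π g).resolve_left
    (Submodule.nontrivial_iff_ne_bot.1 hne)

theorem IsIrreducible.qRep [CompleteSpace H] {f : G →ₜ* Q} (hf : DenseRange f)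
    {π : UnitaryRep G H} (h : π.IsIrreducible) (hne : Nontrivial (qVectors f π)) :
    (π.qRep f hf).IsIrreducible := by
  have htop := h.qVectors_eq_top hf hne
  refine ⟨hne, fun V hV hinv => ?_⟩
  have hcl : IsClosed ((V.map (qVectors f π).subtype : Submodule ℂ H) : Set H) := by
    rw [Submodule.map_coe]
    exact (isClosed_qVectors f hf π).isClosedEmbedding_subtypeVal.isClosedMap _ hV
  have hG : ∀ g : G, ∀ ξ ∈ V.map (qVectors f π).subtype,
      π.toHom g ξ ∈ V.map (qVectors f π).subtype := by
    rintro g _ ⟨ξ, hξ, rfl⟩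
    exact ⟨_, hinv (f g) ξ hξ, qRep_map_coe f hf π g ξ⟩
  rcases h.2 _ hcl hG with h0 | h1
  · left
    exact (Submodule.map_injective_of_injective (qVectors f π).injective_subtype)
      (h0.trans (Submodule.map_bot _).symm)
  · right
    refine eq_top_iff.2 fun ξ _ => ?_
    have : (ξ : H) ∈ V.map (qVectors f π).subtype := h1 ▸ Submodule.mem_top
    obtain ⟨η, hη, h⟩ := this
    rwa [← Subtype.ext h]

theorem IsTrivialOne.of_qRep {f : G →ₜ* Q} {hf : DenseRange f} {π : UnitaryRep G H}
    (htop : qVectors f π = ⊤) (h : (π.qRep f hf).IsTrivialOne) : π.IsTrivialOne := by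
  refine ⟨?_, fun g ξ => ?_⟩
  · have := h.1
    rwa [htop, finrank_top] at this
  · rw [← qRep_map_coe f hf π g ⟨ξ, htop ▸ Submodule.mem_top⟩, h.2]

end QRep

end UnitaryRep

/-! ### Finite index under dense homomorphisms. -/

section FiniteIndex

variable {G Q : Type*} [Group G] [TopologicalSpace G] [Group Q] [TopologicalSpace Q]
  [IsTopologicalGroup Q]

/-- The closure of the image of a finite index subgroup under a homomorphism with dense image
has finite index. -/
theorem finiteIndex_topologicalClosure_map (f : G →ₜ* Q) (hf : DenseRange f) (N : Subgroup G)
    [N.FiniteIndex] : (N.map f.toMonoidHom).topologicalClosure.FiniteIndex := by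
  set S := (N.map f.toMonoidHom).topologicalClosure with hS
  have hcl : IsClosed (S : Set Q) := Subgroup.isClosed_topologicalClosure _
  have hfS : ∀ n ∈ N, f n ∈ S := fun n hn =>
    Subgroup.le_topologicalClosure _ (Subgroup.mem_map_of_mem f.toMonoidHom hn)
  -- Finitely many closed cosets of `S` cover $f(G)$; their union is closed, hence all of $Q$.
  let T : G ⧸ N → Set Q := fun c => {q | (f c.out)⁻¹ * q ∈ S}
  have hT : IsClosed (⋃ c, T c) :=
    isClosed_iUnion_of_finite fun c => hcl.preimage (continuous_const_mul _)
  have hsub : Set.range f ⊆ ⋃ c, T c := by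
    rintro _ ⟨g, rfl⟩
    refine Set.mem_iUnion.2 ⟨(g : G ⧸ N), ?_⟩
    have h1 : ((g : G ⧸ N).out)⁻¹ * g ∈ N :=
      QuotientGroup.eq.1 (QuotientGroup.out_eq' (g : G ⧸ N))
    simpa [T] using hfS _ h1
  have hsurj : Function.Surjective fun c : G ⧸ N => (f c.out : Q ⧸ S) := by
    intro x
    obtain ⟨q, rfl⟩ := QuotientGroup.mk_surjective x
    obtain ⟨c, hc⟩ := Set.mem_iUnion.1 (hT.closure_subset_iff.2 hsub (hf q))
    exact ⟨c, QuotientGroup.eq.2 hc⟩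
  have : Finite (Q ⧸ S) := Finite.of_surjective _ hsurj
  exact Subgroup.finiteIndex_of_finite_quotient

/-- The kernel of $\pi^Q$ is closed and contains $f(\ker\pi)$, hence contains a closed subgroup of
finite index. -/
theorem UnitaryRep.IsFinite.qRep {f : G →ₜ* Q} (hf : DenseRange f) {H : Type*}
    [NormedAddCommGroup H] [InnerProductSpace ℂ H] {π : UnitaryRep G H} (h : π.IsFinite) :
    (π.qRep f hf).IsFinite := by
  have : π.toHom.ker.FiniteIndex := h
  have h2 := finiteIndex_topologicalClosure_map f hf π.toHom.ker
  refine Subgroup.finiteIndex_of_le (H := (π.toHom.ker.map f.toMonoidHom).topologicalClosure) ?_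
  intro q hq
  refine MonoidHom.mem_ker.2 (LinearIsometryEquiv.ext fun ξ => ?_)
  have hcl : IsClosed {q | (π.qRep f hf).toHom q ξ = ξ} :=
    isClosed_eq ((π.qRep f hf).continuous_orbit ξ) continuous_const
  refine hcl.closure_subset_iff.2 ?_ hq
  rintro _ ⟨g, hg, rfl⟩
  refine Subtype.ext ((UnitaryRep.qRep_map_coe f hf π g ξ).trans ?_)
  rw [MonoidHom.mem_ker.1 hg]
  rfl

end FiniteIndex

/-! ### Hilbert sums of unitary representations. -/

section HilbertSum

variable {ι : Type*} {H : ι → Type*} [∀ i, NormedAddCommGroup (H i)]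

theorem lp.hasSum_norm_sq (ξ : lp H 2) : HasSum (fun i => ‖ξ i‖ ^ 2) (‖ξ‖ ^ 2) := by
  have := lp.hasSum_norm (p := 2) (by norm_num) ξ
  simpa using this

variable [∀ i, InnerProductSpace ℂ (H i)]

/-- The coordinatewise action of a family of linear isometries on a Hilbert sum. -/
noncomputable def lp.mapIsometry (e : ∀ i, H i ≃ₗᵢ[ℂ] H i) : lp H 2 →ₗᵢ[ℂ] lp H 2 where
  toFun ξ := ⟨fun i => e i (ξ i), (memℓp_gen_iff (p := 2) (by norm_num)).2 <| by
    simpa using (lp.hasSum_norm_sq ξ).summable⟩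
  map_add' ξ η := by ext i; exact map_add (e i) _ _
  map_smul' c ξ := by ext i; exact map_smul (e i) _ _
  norm_map' ξ := by
    have h := lp.hasSum_norm_sq (H := H) ⟨fun i => e i (ξ i),
      (memℓp_gen_iff (p := 2) (by norm_num)).2 <| by
        simpa using (lp.hasSum_norm_sq ξ).summable⟩
    simp only [LinearIsometryEquiv.norm_map] at h
    have := h.unique (lp.hasSum_norm_sq ξ)
    exact (pow_left_inj₀ (norm_nonneg _) (norm_nonneg _) two_ne_zero).1 this

/-- The coordinatewise action of a family of unitary operators on a Hilbert sum. -/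
noncomputable def lp.mapIsometryEquiv (e : ∀ i, H i ≃ₗᵢ[ℂ] H i) : lp H 2 ≃ₗᵢ[ℂ] lp H 2 :=
  { lp.mapIsometry e with
    invFun := lp.mapIsometry fun i => (e i).symm
    left_inv := fun ξ => by ext i; exact (e i).symm_apply_apply (ξ i)
    right_inv := fun ξ => by ext i; exact (e i).apply_symm_apply (ξ i) }

@[simp] theorem lp.mapIsometryEquiv_apply (e : ∀ i, H i ≃ₗᵢ[ℂ] H i) (ξ : lp H 2) (i : ι) :
    lp.mapIsometryEquiv e ξ i = e i (ξ i) := rfl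

namespace UnitaryRep

variable {G : Type*} [Group G] [TopologicalSpace G]

/-- The Hilbert sum of a family of unitary representations. -/
noncomputable def hilbertSum (π : ∀ i, UnitaryRep G (H i)) : UnitaryRep G (lp H 2) where
  toHom :=
    { toFun := fun g => lp.mapIsometryEquiv fun i => (π i).toHom g
      map_one' := by ext ξ i; simp
      map_mul' := fun g h => by ext ξ i; simp }
  continuous_orbit ξ := by
    refine continuous_iff_continuousAt.2 fun g₀ => tendsto_iff_norm_sub_tendsto_zero.2 ?_
    change Tendsto (fun g => ‖lp.mapIsometryEquiv (fun i => (π i).toHom g) ξ -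
      lp.mapIsometryEquiv (fun i => (π i).toHom g₀) ξ‖) (𝓝 g₀) (𝓝 0)
    -- Each term is at most $(2\|\xi_i\|)^2$, a summable bound independent of `g`, so the series of
    -- continuous functions converges uniformly.
    have hc : Continuous fun g => ∑' i, ‖(π i).toHom g (ξ i) - (π i).toHom g₀ (ξ i)‖ ^ 2 := by
      refine continuous_tsum (u := fun i => 4 * ‖ξ i‖ ^ 2)
        (fun i => (((π i).continuous_orbit (ξ i)).sub continuous_const).norm.pow 2)
        ((lp.hasSum_norm_sq ξ).summable.mul_left 4) fun i g => ?_
      have h1 := norm_sub_le ((π i).toHom g (ξ i)) ((π i).toHom g₀ (ξ i))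
      simp only [LinearIsometryEquiv.norm_map] at h1
      rw [Real.norm_of_nonneg (by positivity)]
      nlinarith [norm_nonneg ((π i).toHom g (ξ i) - (π i).toHom g₀ (ξ i))]
    have h0 := (hc.tendsto g₀).sqrt
    simp only [sub_self, norm_zero, ne_eq, OfNat.ofNat_ne_zero, not_false_eq_true, zero_pow,
      tsum_zero, Real.sqrt_zero] at h0
    refine h0.congr fun g => ?_
    have := (lp.hasSum_norm_sq (lp.mapIsometryEquiv (fun i => (π i).toHom g) ξ -
      lp.mapIsometryEquiv (fun i => (π i).toHom g₀) ξ)).tsum_eq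
    simp only [lp.coeFn_sub, Pi.sub_apply, lp.mapIsometryEquiv_apply] at this
    rw [this, Real.sqrt_sq (norm_nonneg _)]

@[simp] theorem hilbertSum_apply (π : ∀ i, UnitaryRep G (H i)) (g : G) (ξ : lp H 2) (i : ι) :
    (hilbertSum π).toHom g ξ i = (π i).toHom g (ξ i) := rfl

theorem hilbertSum_single [DecidableEq ι] (π : ∀ i, UnitaryRep G (H i)) (g : G) (i : ι) (ξ : H i) :
    (hilbertSum π).toHom g (lp.single 2 i ξ) = lp.single 2 i ((π i).toHom g ξ) := by
  ext j
  rw [hilbertSum_apply]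
  by_cases h : j = i
  · subst h
    simp
  · simp [Pi.single_eq_of_ne h]

theorem HasAlmostInvariantVector.hilbertSum {π : ∀ i, UnitaryRep G (H i)} {K : Set G} {ε : ℝ}
    {i : ι} (h : (π i).HasAlmostInvariantVector K ε) :
    (hilbertSum π).HasAlmostInvariantVector K ε := by
  classical
  obtain ⟨ξ, h0, h⟩ := h
  have hn : ∀ η : H i, ‖(lp.single 2 i η : lp H 2)‖ = ‖η‖ := fun η =>
    lp.norm_single (by norm_num) i η
  refine ⟨lp.single 2 i ξ, fun h1 => h0 ?_, fun g hg => ?_⟩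
  · rw [← norm_eq_zero, ← hn, h1, norm_zero]
  · rw [hilbertSum_single, ← lp.single_sub, hn, hn]
    exact h g hg

end UnitaryRep

end HilbertSum

/-! ### Haar averaging and almost invariant coordinates. -/

section Averaging

open MeasureTheory
open scoped Pointwise

variable {L : Type*} [Group L] [TopologicalSpace L] [IsTopologicalGroup L]
  [LocallyCompactSpace L] [T2Space L]

/-- Displacement of a vector on `K` is controlled by its mean square displacement on a larger
compact set. -/
theorem exists_compact_sq_displacement_le (K : Set L) (hK : IsCompact K) :
    ∃ K' : Set L, IsCompact K' ∧ ∃ (_ : MeasurableSpace L) (_ : BorelSpace L) (μ : Measure L)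
      (C : ℝ), 0 < C ∧ μ K' ≠ ⊤ ∧ MeasurableSet K' ∧ IsFiniteMeasureOnCompacts μ ∧ 0 < μ.real K' ∧
      ∀ {H : Type u} [NormedAddCommGroup H] [InnerProductSpace ℂ H] (π : UnitaryRep L H) (ξ : H),
        ∀ h ∈ K, ‖π.toHom h ξ - ξ‖ ^ 2 ≤ C * ∫ g in K', ‖π.toHom g ξ - ξ‖ ^ 2 ∂μ := by
  let m : MeasurableSpace L := borel L
  have hb : BorelSpace L := ⟨rfl⟩
  let μ : Measure L := Measure.haar
  obtain ⟨K₀, hK₀, h1⟩ := exists_compact_mem_nhds (1 : L)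
  have hμ₀ : 0 < μ.real K₀ :=
    ENNReal.toReal_pos (Measure.measure_pos_of_mem_nhds μ h1).ne' hK₀.measure_lt_top.ne
  -- The displacement by `h` is bounded through the displacements by `g` and `h * g`; averaging over
  -- `g` in `K₀`, left invariance turns the second term into an integral over $hK_0\subset KK_0$.
  -- Each of the two integrals enters with factor 2, whence the 4.
  have hc : IsCompact (K₀ ∪ K * K₀) := hK₀.union (hK.mul hK₀)
  refine ⟨K₀ ∪ K * K₀, hc, m, hb, μ, 4 / μ.real K₀, by positivity, hc.measure_lt_top.ne,
    hc.measurableSet, inferInstance,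
    hμ₀.trans_le (measureReal_mono Set.subset_union_left hc.measure_lt_top.ne), ?_⟩
  intro H _ _ π ξ h hh
  set F : L → ℝ := fun g => ‖π.toHom g ξ - ξ‖ ^ 2 with hF
  have hFc : Continuous F := ((π.continuous_orbit ξ).sub continuous_const).norm.pow 2
  have hF0 : ∀ g, 0 ≤ F g := fun g => by positivity
  have hFi : IntegrableOn F (K₀ ∪ K * K₀) μ := hFc.continuousOn.integrableOn_compact hc
  have hsub : ∀ S ⊆ K₀ ∪ K * K₀, ∫ g in S, F g ∂μ ≤ ∫ g in K₀ ∪ K * K₀, F g ∂μ := fun S hS =>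
    setIntegral_mono_set hFi (ae_of_all _ hF0) (LE.le.eventuallyLE hS)
  have htr : ∫ g in K₀, F (h * g) ∂μ = ∫ g in (fun g => h * g) '' K₀, F g ∂μ := by
    have hmp := measurePreserving_mul_left μ h
    rw [hmp.setIntegral_image_emb (MeasurableEquiv.mulLeft h).measurableEmbedding]
  have hpt : ∀ g, ‖π.toHom h ξ - ξ‖ ^ 2 ≤ 2 * F g + 2 * F (h * g) := by
    intro g
    have e1 : ‖π.toHom h ξ - π.toHom (h * g) ξ‖ = ‖π.toHom g ξ - ξ‖ := by
      rw [map_mul, LinearIsometryEquiv.coe_mul, Function.comp_apply, ← map_sub, LinearIsometryEquiv.norm_map,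
        norm_sub_rev]
    have e2 := norm_sub_le_norm_sub_add_norm_sub (π.toHom h ξ) (π.toHom (h * g) ξ) ξ
    rw [e1] at e2
    simp only [hF]
    nlinarith [sq_nonneg (‖π.toHom g ξ - ξ‖ - ‖π.toHom (h * g) ξ - ξ‖),
      norm_nonneg (π.toHom h ξ - ξ)]
  have i1 : IntegrableOn F K₀ μ := hFi.mono_set Set.subset_union_left
  have i2 : IntegrableOn (fun g => F (h * g)) K₀ μ :=
    (hFc.comp (continuous_const_mul h)).continuousOn.integrableOn_compact hK₀
  have hint : μ.real K₀ * ‖π.toHom h ξ - ξ‖ ^ 2 ≤ ∫ g in K₀, (2 * F g + 2 * F (h * g)) ∂μ := by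
    have := setIntegral_mono (μ := μ) (s := K₀) (f := fun _ => ‖π.toHom h ξ - ξ‖ ^ 2)
      (g := fun g => 2 * F g + 2 * F (h * g))
      (integrableOn_const hK₀.measure_lt_top.ne) ((i1.const_mul 2).add (i2.const_mul 2)) hpt
    simpa using this
  rw [integral_add (i1.const_mul 2) (i2.const_mul 2), integral_const_mul, integral_const_mul,
    htr] at hint
  have b1 := hsub K₀ Set.subset_union_left
  have b2 := hsub ((fun g => h * g) '' K₀) (by
    rintro _ ⟨g, hg, rfl⟩
    exact Or.inr (Set.mul_mem_mul hh hg))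
  rw [div_mul_eq_mul_div, le_div_iff₀ hμ₀]
  linarith

/-- An almost invariant vector of a sum of representations has an almost invariant coordinate. -/
theorem exists_almostInvariant_coordinate (K : Set L) (hK : IsCompact K) {ε : ℝ} (hε : 0 < ε) :
    ∃ K' : Set L, IsCompact K' ∧ ∃ δ > 0, ∀ {ι : Type*} {H : ι → Type u}
      [∀ i, NormedAddCommGroup (H i)] [∀ i, InnerProductSpace ℂ (H i)]
      (ρ : ∀ i, UnitaryRep L (H i)) (ξ : ∀ i, H i) (c : ℝ), 0 < c →
      HasSum (fun i => ‖ξ i‖ ^ 2) c →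
      (∀ g ∈ K', ∀ s : Finset ι, ∑ i ∈ s, ‖(ρ i).toHom g (ξ i) - ξ i‖ ^ 2 ≤ δ * c) →
      ∃ i, (ρ i).HasAlmostInvariantVector K ε := by
  obtain ⟨K', hK', m, hb, μ, C, hC, hμ, hmeas, hfin, hμ0, hdis⟩ :=
    exists_compact_sq_displacement_le.{u} K hK
  -- This makes $C\cdot 2\delta\mu(K')=\varepsilon^2$, where the 2 leaves room for a strict
  -- inequality below.
  refine ⟨K', hK', ε ^ 2 / (2 * C * μ.real K'), by positivity, ?_⟩
  intro ι H _ _ ρ ξ c hc hsum hξ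
  set δ := ε ^ 2 / (2 * C * μ.real K') with hδ
  have hδ0 : 0 < δ := by positivity
  have hint : ∀ i, IntegrableOn (fun g => ‖(ρ i).toHom g (ξ i) - ξ i‖ ^ 2) K' μ := fun i =>
    ((((ρ i).continuous_orbit (ξ i)).sub continuous_const).norm.pow
      2).continuousOn.integrableOn_compact hK'
  -- A coordinate chosen for each `g` separately would depend on `g`. Integrating first gives one
  -- coordinate for all `g`, and `hdis` returns from the integral to a uniform bound on `K`.
  -- Strictness also forces $\xi_i\ne0$.
  have hex : ∃ i, ∫ g in K', ‖(ρ i).toHom g (ξ i) - ξ i‖ ^ 2 ∂μ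
      < 2 * δ * μ.real K' * ‖ξ i‖ ^ 2 := by
    by_contra! hcon
    have hle : 2 * δ * μ.real K' * c ≤ δ * c * μ.real K' := by
      refine le_of_tendsto' (hsum.mul_left (2 * δ * μ.real K')) fun s => ?_
      calc ∑ i ∈ s, 2 * δ * μ.real K' * ‖ξ i‖ ^ 2
          ≤ ∑ i ∈ s, ∫ g in K', ‖(ρ i).toHom g (ξ i) - ξ i‖ ^ 2 ∂μ :=
            Finset.sum_le_sum fun i _ => hcon i
        _ = ∫ g in K', ∑ i ∈ s, ‖(ρ i).toHom g (ξ i) - ξ i‖ ^ 2 ∂μ :=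
            (integral_finsetSum s fun i _ => hint i).symm
        _ ≤ ∫ _ in K', δ * c ∂μ :=
            setIntegral_mono_on (integrable_finsetSum s fun i _ => hint i)
              (integrableOn_const hμ) hmeas fun g hg => hξ g hg s
        _ = δ * c * μ.real K' := by simp [mul_comm]
    have : 0 < δ * c * μ.real K' := by positivity
    linarith
  obtain ⟨i, hi⟩ := hex
  have hne : ξ i ≠ 0 := fun h0 => by
    simp [h0] at hi
  refine ⟨i, ξ i, hne, fun g hg => ?_⟩
  have h1 := hdis (ρ i) (ξ i) g hg
  have h2 : ‖(ρ i).toHom g (ξ i) - ξ i‖ ^ 2 ≤ (ε * ‖ξ i‖) ^ 2 := by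
    refine h1.trans ((mul_le_mul_of_nonneg_left hi.le hC.le).trans_eq ?_)
    rw [hδ]
    field_simp
  exact (pow_le_pow_iff_left₀ (norm_nonneg _) (by positivity) two_ne_zero).1 h2

end Averaging

/-! ### Resolutions applied to Hilbert sums. -/

section Resolution

variable {G Q : Type u} [Group G] [TopologicalSpace G] [Group Q] [TopologicalSpace Q]
  [IsTopologicalGroup Q] [LocallyCompactSpace Q] [T2Space Q]

open UnitaryRep

/-- If a family of representations of `G` has members arbitrarily close to `1_G`, then some
member's `Q`-part is arbitrarily close to `1_Q`. -/
theorem IsResolution.exists_qRep_almostInvariant {f : G →ₜ* Q} (hf : IsResolution f) {ι : Type u}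
    {H : ι → Type u} [∀ i, NormedAddCommGroup (H i)] [∀ i, InnerProductSpace ℂ (H i)]
    [∀ i, CompleteSpace (H i)] (π : ∀ i, UnitaryRep G (H i))
    (hπ : ∀ K : Set G, IsCompact K → ∀ ε : ℝ, 0 < ε → ∃ i, (π i).HasAlmostInvariantVector K ε)
    (K : Set Q) (hK : IsCompact K) {ε : ℝ} (hε : 0 < ε) :
    ∃ i, ((π i).qRep f hf.dense).HasAlmostInvariantVector K ε := by
  obtain ⟨K', hK', δ, hδ, hcoord⟩ := exists_almostInvariant_coordinate.{u} K hK hε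
  obtain ⟨ξ, hξ0, hξ⟩ := hf.almost (lp H 2) (UnitaryRep.hilbertSum π)
    (fun K hK ε hε => (hπ K hK ε hε).elim fun i hi => hi.hilbertSum) K' hK' (√δ) (by positivity)
  set ρ := (UnitaryRep.hilbertSum π).qRep f hf.dense with hρ
  -- Coordinate projections are continuous and equivariant, so they send $Q$-vectors of the sum to
  -- $Q$-vectors of the summands.
  have hw : ∀ i, IsOrbitFactor f (π i) ((ξ : lp H 2) i)
      (fun q => ((ρ.toHom q ξ : qVectors f _) : lp H 2) i) := fun i => by
    refine ⟨?_, fun g => ?_⟩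
    · exact (lp.lipschitzWith_one_eval 2 i).continuous.comp
        (continuous_subtype_val.comp (ρ.continuous_orbit ξ))
    · exact congrArg (fun ζ : lp H 2 => ζ i) (qRep_map_coe f hf.dense (UnitaryRep.hilbertSum π) g ξ)
  let η : ∀ i, qVectors f (π i) := fun i => ⟨(ξ : lp H 2) i, _, hw i⟩
  have hact : ∀ q i, ((((π i).qRep f hf.dense).toHom q (η i) : qVectors f (π i)) : H i)
      = ((ρ.toHom q ξ : qVectors f _) : lp H 2) i := fun q i =>
    congrFun (orbitFactor_eq hf.dense (ξ := η i) (hw i)) q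
  refine hcoord (fun i => (π i).qRep f hf.dense) η (‖ξ‖ ^ 2) (by positivity)
    (lp.hasSum_norm_sq (ξ : lp H 2)) fun q hq s => ?_
  have hs := lp.hasSum_norm_sq ((ρ.toHom q ξ - ξ : qVectors f _) : lp H 2)
  have hle := sum_le_hasSum s (fun i _ => by positivity) hs
  have hnorm := pow_le_pow_left₀ (norm_nonneg _) (hξ q hq) 2
  rw [mul_pow, Real.sq_sqrt hδ.le] at hnorm
  refine le_trans (le_of_eq ?_) (hle.trans hnorm)
  refine Finset.sum_congr rfl fun i _ => ?_
  exact congrArg (fun v => ‖v - (ξ : lp H 2) i‖ ^ 2) (hact q i)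

end Resolution

open UnitaryRep

/-! ### Nets converging to the trivial representation versus a single pair $(K,\varepsilon)$. -/

section Isolation

variable (L : Type u) [Group L] [TopologicalSpace L]

/-- The trivial representation is isolated among the irreducible representations satisfying `P`,
witnessed by a single pair `(K, ε)`. -/
def IsTrivialIsolated
    (P : ∀ (H : Type u) [NormedAddCommGroup H] [InnerProductSpace ℂ H], UnitaryRep L H → Prop) :
    Prop :=
  ∃ K : Set L, IsCompact K ∧ ∃ ε : ℝ, 0 < ε ∧
    ∀ (H : Type u) [NormedAddCommGroup H] [InnerProductSpace ℂ H] [CompleteSpace H]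
      (π : UnitaryRep L H), π.IsIrreducible → P H π → π.HasAlmostInvariantVector K ε →
        π.IsTrivialOne

variable {L}

/-- Failing isolation produces representations satisfying `P` that are nontrivial and
`(K, 1 / (n + 1))`-invariant, indexed by `K` and `n`. -/
theorem exists_family_of_not_isTrivialIsolated
    {P : ∀ (H : Type u) [NormedAddCommGroup H] [InnerProductSpace ℂ H], UnitaryRep L H → Prop}
    (h : ¬ IsTrivialIsolated L P) :
    ∃ (H : TopologicalSpace.Compacts L × ℕ → Type u) (_ : ∀ i, NormedAddCommGroup (H i))
      (_ : ∀ i, InnerProductSpace ℂ (H i)) (_ : ∀ i, CompleteSpace (H i))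
      (π : ∀ i, UnitaryRep L (H i)), ∀ i, (π i).IsIrreducible ∧ P (H i) (π i) ∧
        (π i).HasAlmostInvariantVector (i.1 : Set L) (1 / ((i.2 : ℝ) + 1)) ∧
        ¬ (π i).IsTrivialOne := by
  have : ∀ i : TopologicalSpace.Compacts L × ℕ, ∃ (H : Type u) (_ : NormedAddCommGroup H)
      (_ : InnerProductSpace ℂ H) (_ : CompleteSpace H) (π : UnitaryRep L H),
      π.IsIrreducible ∧ P H π ∧ π.HasAlmostInvariantVector (i.1 : Set L) (1 / ((i.2 : ℝ) + 1)) ∧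
        ¬ π.IsTrivialOne := by
    intro i
    by_contra! hcon
    exact h ⟨i.1, i.1.isCompact, 1 / ((i.2 : ℝ) + 1), by positivity,
      fun H _ _ _ π h1 h2 h3 => hcon H _ _ ‹_› π h1 h2 h3⟩
  choose H h1 h2 h3 π hπ using this
  exact ⟨H, h1, h2, h3, π, hπ⟩

theorem tendstoTrivial_of_compacts {H : TopologicalSpace.Compacts L × ℕ → Type u}
    [∀ i, NormedAddCommGroup (H i)] [∀ i, InnerProductSpace ℂ (H i)]
    (π : ∀ i, UnitaryRep L (H i))
    (hπ : ∀ i, (π i).HasAlmostInvariantVector (i.1 : Set L) (1 / ((i.2 : ℝ) + 1))) :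
    TendstoTrivial π := by
  intro K hK ε hε
  obtain ⟨n, hn⟩ := exists_nat_one_div_lt hε
  filter_upwards [eventually_ge_atTop ((⟨K, hK⟩ : TopologicalSpace.Compacts L), n)] with i hi
  refine (hπ i).mono hi.1 (le_trans ?_ hn.le)
  have : (n : ℝ) ≤ i.2 := by exact_mod_cast hi.2
  gcongr

/-- If no pair isolates $1_L$, choosing a counterexample for each compact set and each `n` gives a
net over a directed set that lies in the universe of `L`; it converges to $1_L$ and is never
trivial. -/
theorem propertyTau_iff : PropertyTau L ↔ IsTrivialIsolated L fun _ _ _ π => π.IsFinite := by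
  constructor
  · intro h
    by_contra hcon
    obtain ⟨H, _, _, _, π, hπ⟩ := exists_family_of_not_isTrivialIsolated hcon
    obtain ⟨i, hi⟩ := (h _ H π (fun i => (hπ i).1) (fun i => (hπ i).2.1)
      (tendstoTrivial_of_compacts π fun i => (hπ i).2.2.1)).exists
    exact (hπ i).2.2.2 hi
  · rintro ⟨K, hK, ε, hε, h⟩ ι _ _ _ H _ _ _ π hirr hP ht
    filter_upwards [ht K hK ε hε] with i hi using h _ _ (hirr i) (hP i) hi

theorem propertyTauFD_iff :
    PropertyTauFD L ↔ IsTrivialIsolated L fun H _ _ _ => FiniteDimensional ℂ H := by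
  constructor
  · intro h
    by_contra hcon
    obtain ⟨H, _, _, _, π, hπ⟩ := exists_family_of_not_isTrivialIsolated hcon
    obtain ⟨i, hi⟩ := (h _ H π (fun i => (hπ i).1) (fun i => (hπ i).2.1)
      (tendstoTrivial_of_compacts π fun i => (hπ i).2.2.1)).exists
    exact (hπ i).2.2.2 hi
  · rintro ⟨K, hK, ε, hε, h⟩ ι _ _ _ H _ _ _ π hirr hP ht
    filter_upwards [ht K hK ε hε] with i hi using h _ _ (hirr i) (hP i) hi

end Isolation

/-! ### Transfer of (T), $(\tau)$ and $(\tau_{FD})$. -/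

section Transfer

variable {G Q : Type u} [Group G] [TopologicalSpace G] [Group Q] [TopologicalSpace Q]
  [IsTopologicalGroup Q] [LocallyCompactSpace Q] [T2Space Q]

/-- Common to finite and finite-dimensional representations: only stability under pullback and under
$\pi\mapsto\pi^Q$ matters. In a family of counterexamples on $G$, some member has a $Q$-part with an
invariant vector for the isolating pair of $Q$. This $Q$-part is nonzero, hence everything, hence
trivial. -/
theorem IsResolution.isTrivialIsolated_iff {f : G →ₜ* Q} (hf : IsResolution f)
    {P : ∀ (H : Type u) [NormedAddCommGroup H] [InnerProductSpace ℂ H], UnitaryRep G H → Prop}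
    {P' : ∀ (H : Type u) [NormedAddCommGroup H] [InnerProductSpace ℂ H], UnitaryRep Q H → Prop}
    (hpull : ∀ (H : Type u) [NormedAddCommGroup H] [InnerProductSpace ℂ H] (ρ : UnitaryRep Q H),
      P' H ρ → P H (ρ.pullback f))
    (hq : ∀ (H : Type u) [NormedAddCommGroup H] [InnerProductSpace ℂ H] (π : UnitaryRep G H),
      P H π → P' (qVectors f π) (π.qRep f hf.dense)) :
    IsTrivialIsolated G P ↔ IsTrivialIsolated Q P' := by
  constructor
  · rintro ⟨K, hK, ε, hε, h⟩
    refine ⟨f '' K, hK.image f.continuous_toFun, ε, hε, fun H _ _ _ ρ hirr hP hinv => ?_⟩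
    exact (h H (ρ.pullback f) (hirr.pullback hf.dense) (hpull H ρ hP)
      hinv.pullback).of_pullback hf.dense
  · rintro ⟨K, hK, ε, hε, h⟩
    by_contra hcon
    obtain ⟨H, _, _, _, π, hπ⟩ := exists_family_of_not_isTrivialIsolated hcon
    obtain ⟨i, hi⟩ := hf.exists_qRep_almostInvariant π (fun K hK ε hε => by
      obtain ⟨n, hn⟩ := exists_nat_one_div_lt hε
      exact ⟨(⟨K, hK⟩, n), (hπ _).2.2.1.mono subset_rfl hn.le⟩) K hK hε
    have hne : Nontrivial (qVectors f (π i)) := by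
      obtain ⟨ξ, h0, -⟩ := hi
      exact ⟨ξ, 0, h0⟩
    have : CompleteSpace (qVectors f (π i)) :=
      (isClosed_qVectors f hf.dense (π i)).completeSpace_coe
    refine (hπ i).2.2.2 (IsTrivialOne.of_qRep (hf := hf.dense)
      ((hπ i).1.qVectors_eq_top hf.dense hne) ?_)
    exact h _ _ ((hπ i).1.qRep hf.dense hne) (hq _ _ (hπ i).2.1) hi

theorem IsResolution.propertyTau_iff {f : G →ₜ* Q} (hf : IsResolution f) :
    PropertyTau G ↔ PropertyTau Q := by
  rw [_root_.propertyTau_iff, _root_.propertyTau_iff]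
  exact hf.isTrivialIsolated_iff (fun _ _ _ _ h => h.pullback f) fun _ _ _ _ h => h.qRep hf.dense

theorem IsResolution.propertyTauFD_iff {f : G →ₜ* Q} (hf : IsResolution f) :
    PropertyTauFD G ↔ PropertyTauFD Q := by
  rw [_root_.propertyTauFD_iff, _root_.propertyTauFD_iff]
  exact hf.isTrivialIsolated_iff (fun _ _ _ _ h => h) fun _ _ _ _ h => by
    have : FiniteDimensional ℂ _ := h
    infer_instance

omit [LocallyCompactSpace Q] [T2Space Q] in
theorem IsResolution.propertyT_iff {f : G →ₜ* Q} (hf : IsResolution f) :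
    PropertyT G ↔ PropertyT Q := by
  constructor
  · intro h H _ _ _ ρ hρ
    exact (h H (ρ.pullback f) hρ.pullback).of_pullback hf.dense
  · intro h H _ _ _ π hπ
    have : CompleteSpace (qVectors f π) := (isClosed_qVectors f hf.dense π).completeSpace_coe
    obtain ⟨ξ, h0, hξ⟩ := h _ (π.qRep f hf.dense) (hf.almost H π hπ)
    refine ⟨ξ, fun h => h0 (Subtype.ext h), fun g => ?_⟩
    rw [← qRep_map_coe f hf.dense, hξ]

end Transfer

/-! ### The Koopman representation of a Euclidean isometric action. -/

section KoopmanRepresentation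

open MeasureTheory

variable {G : Type*} [Group G] [TopologicalSpace G] [IsTopologicalGroup G]
  {E : Type*} [NormedAddCommGroup E] [InnerProductSpace ℝ E] [FiniteDimensional ℝ E]
  [MeasurableSpace E] [BorelSpace E]

/-- The measure on a finite-dimensional Euclidean space used for Koopman representations; it is
invariant under all isometries. -/
noncomputable abbrev euclideanMeasure (E : Type*) [NormedAddCommGroup E] [InnerProductSpace ℝ E]
    [FiniteDimensional ℝ E] [MeasurableSpace E] [BorelSpace E] : Measure E :=
  μH[Module.finrank ℝ E]

theorem IsometryEquiv.measurePreserving_euclideanMeasure (e : E ≃ᵢ E) :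
    MeasurePreserving e (euclideanMeasure E) (euclideanMeasure E) :=
  e.measurePreserving_hausdorffMeasure _

/-- The unitary representation on `L²(E)` associated with a continuous isometric action. -/
noncomputable def koopman (α : G →* (E ≃ᵢ E)) (hα : ∀ x : E, Continuous fun g => α g x) :
    UnitaryRep G (Lp ℂ 2 (euclideanMeasure E)) where
  toHom :=
    { toFun := fun g =>
        { Lp.compMeasurePreservingₗᵢ ℂ (α g⁻¹) (α g⁻¹).measurePreserving_euclideanMeasure with
          invFun := Lp.compMeasurePreservingₗᵢ ℂ (α g) (α g).measurePreserving_euclideanMeasure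
          left_inv := fun ξ => by
            refine (Lp.compMeasurePreserving_comp_apply ξ
              (α g⁻¹).measurePreserving_euclideanMeasure
              (α g).measurePreserving_euclideanMeasure).symm.trans ?_
            have : (α g⁻¹ : E → E) ∘ α g = id := by ext x; simp [map_inv]
            simp only [this, Lp.compMeasurePreserving_id_apply]
          right_inv := fun ξ => by
            refine (Lp.compMeasurePreserving_comp_apply ξ
              (α g).measurePreserving_euclideanMeasure
              (α g⁻¹).measurePreserving_euclideanMeasure).symm.trans ?_
            have : (α g : E → E) ∘ α g⁻¹ = id := by ext x; simp [map_inv]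
            simp only [this, Lp.compMeasurePreserving_id_apply] }
      map_one' := by
        refine LinearIsometryEquiv.ext fun ξ => ?_
        change Lp.compMeasurePreserving (α 1⁻¹) _ ξ = ξ
        have : (α 1⁻¹ : E → E) = id := by ext x; simp
        simp only [this, Lp.compMeasurePreserving_id_apply]
      map_mul' := fun g h => by
        refine LinearIsometryEquiv.ext fun ξ => ?_
        refine Eq.trans ?_ (Lp.compMeasurePreserving_comp_apply ξ
          (α h⁻¹).measurePreserving_euclideanMeasure (α g⁻¹).measurePreserving_euclideanMeasure)
        change Lp.compMeasurePreserving (α (g * h)⁻¹) _ ξ = _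
        have : (α (g * h)⁻¹ : E → E) = α h⁻¹ ∘ α g⁻¹ := by ext x; simp [mul_inv_rev]
        simp only [this] }
  continuous_orbit ξ := by
    -- Separate continuity together with the uniform Lipschitz constant 1 gives joint continuity,
    -- hence continuity of `c` for the compact-open topology; composition in $L^2$ depends
    -- continuously on `c`.
    let c : G → C(E, E) := fun g => ⟨α g⁻¹, (α g⁻¹).continuous⟩
    have hc : Continuous c := by
      refine ContinuousMap.continuous_of_continuous_uncurry _ ?_
      have h := continuous_prod_of_continuous_lipschitzWith (fun p : E × G => α p.2⁻¹ p.1) 1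
        (fun x => (hα x).comp continuous_inv) fun g => (α g⁻¹).isometry.lipschitz
      exact h.comp continuous_swap
    exact (continuous_const (y := ξ)).compMeasurePreservingLp hc
      (fun g => (α g⁻¹).measurePreserving_euclideanMeasure) (by norm_num)

variable {α : G →* (E ≃ᵢ E)} {hα : ∀ x : E, Continuous fun g => α g x}

theorem koopman_apply (g : G) (ξ : Lp ℂ 2 (euclideanMeasure E)) :
    (koopman α hα).toHom g ξ =
      Lp.compMeasurePreserving (α g⁻¹) (α g⁻¹).measurePreserving_euclideanMeasure ξ := rfl

/-- Indicators of large balls are almost invariant. -/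
theorem koopman_almostHasInvariantVectors : (koopman α hα).AlmostHasInvariantVectors := by
  intro K hK ε hε
  obtain ⟨C, hC⟩ := hK.exists_bound_of_continuousOn (hα 0).continuousOn
  set d := Module.finrank ℝ E
  set C' := max C 0
  have hC' : ∀ g ∈ K, ‖α g 0‖ ≤ C' := fun g hg => (hC g hg).trans (le_max_left _ _)
  have hC0 : 0 ≤ C' := le_max_right _ _
  -- The last term ensures $dC'/R\le\varepsilon^2/2$, the bound needed after Bernoulli's inequality
  -- for $(1-C'/R)^d$; `C' + 1` ensures $R>0$ and $R\ge C'$.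
  set R : ℝ := C' + 1 + 2 * d * C' / ε ^ 2 with hR
  have hq0 : 0 ≤ 2 * d * C' / ε ^ 2 := by positivity
  have hR0 : 0 < R := by positivity
  have hRC : C' ≤ R := by rw [hR]; linarith
  set μ := euclideanMeasure E
  set v := μ.real (Metric.ball 0 1)
  have hv : 0 < v := ENNReal.toReal_pos (Metric.measure_ball_pos μ 0 one_pos).ne'
    measure_ball_lt_top.ne
  have hfin : ∀ x r, μ (Metric.closedBall x r) ≠ ⊤ := fun x r => measure_closedBall_lt_top.ne
  have hm : ∀ (x : E) r, MeasurableSet (Metric.closedBall x r) := fun x r => measurableSet_closedBall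
  have hnorm : ∀ (S : Set E) (hS : MeasurableSet S) (hS' : μ S ≠ ⊤),
      ‖indicatorConstLp 2 hS hS' (1 : ℂ)‖ = √(μ.real S) := fun S hS hS' => by
    rw [norm_indicatorConstLp (by norm_num) (by norm_num), Real.sqrt_eq_rpow]
    simp
  refine ⟨indicatorConstLp 2 (hm 0 R) (hfin 0 R) (1 : ℂ), ?_, fun g hg => ?_⟩
  · rw [← norm_ne_zero_iff, hnorm, Measure.addHaar_real_closedBall μ 0 hR0.le]
    positivity
  · rw [koopman_apply, Lp.indicatorConstLp_compMeasurePreserving, ← dist_eq_norm,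
      dist_indicatorConstLp_eq_norm, hnorm, hnorm]
    have hpre : (α g⁻¹ : E → E) ⁻¹' Metric.closedBall 0 R = Metric.closedBall (α g 0) R := by
      rw [IsometryEquiv.preimage_closedBall, map_inv]
      rfl
    rw [hpre]
    set x := α g 0
    have hx : ‖x‖ ≤ C' := hC' g hg
    set A := Metric.closedBall x R
    set B := Metric.closedBall (0 : E) R
    -- A ball contained in both `A` and `B`, so their symmetric difference has at most twice the
    -- volume of a shell of width `C'`.
    set D := Metric.closedBall (0 : E) (R - C')
    have hDA : D ⊆ A := Metric.closedBall_subset_closedBall' (by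
      rw [dist_comm, dist_zero_right]; linarith)
    have hDB : D ⊆ B := Metric.closedBall_subset_closedBall (by linarith)
    have hsub : symmDiff A B ⊆ (A \ D) ∪ (B \ D) := by
      rintro y (⟨h1, h2⟩ | ⟨h1, h2⟩)
      · exact Or.inl ⟨h1, fun h => h2 (hDB h)⟩
      · exact Or.inr ⟨h1, fun h => h2 (hDA h)⟩
    have hAd : μ (A \ D) ≠ ⊤ := measure_ne_top_of_subset Set.sdiff_subset (hfin x R)
    have hBd : μ (B \ D) ≠ ⊤ := measure_ne_top_of_subset Set.sdiff_subset (hfin 0 R)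
    have hle : μ.real (symmDiff A B) ≤ 2 * (R ^ d * v - (R - C') ^ d * v) := by
      have h1 := measureReal_mono hsub (measure_union_ne_top hAd hBd)
      have h2 := measureReal_union_le (μ := μ) (A \ D) (B \ D)
      rw [measureReal_sdiff hDA (hm 0 _) (hfin x R), measureReal_sdiff hDB (hm 0 _) (hfin 0 R),
        Measure.addHaar_real_closedBall μ x hR0.le, Measure.addHaar_real_closedBall μ 0 hR0.le,
        Measure.addHaar_real_closedBall μ 0 (by linarith : 0 ≤ R - C')] at h2
      linarith
    have hbern : R ^ d - (R - C') ^ d ≤ ε ^ 2 / 2 * R ^ d := by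
      have h1 : -1 ≤ -(C' / R) := neg_le_neg ((div_le_one hR0).2 hRC)
      have h2 := one_add_mul_le_pow (a := -(C' / R)) (by linarith) d
      have h3 : (R - C') ^ d = (1 + -(C' / R)) ^ d * R ^ d := by
        rw [← mul_pow]
        congr 1
        field_simp
        ring
      have h4 : d * (C' / R) ≤ ε ^ 2 / 2 := by
        rw [← mul_div_assoc, div_le_iff₀ hR0, hR]
        have : ε ^ 2 / 2 * (2 * d * C' / ε ^ 2) = d * C' := by field_simp
        nlinarith [sq_nonneg ε]
      have hRd : 0 < R ^ d := by positivity
      rw [h3]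
      nlinarith
    rw [← Real.sqrt_sq hε.le, ← Real.sqrt_mul (sq_nonneg ε),
      Measure.addHaar_real_closedBall μ 0 hR0.le]
    refine Real.sqrt_le_sqrt (hle.trans ?_)
    nlinarith

/-- The Koopman representation moves a nonzero vector by a definite amount under isometries with
large translation part. -/
theorem koopman_proper {η : Lp ℂ 2 (euclideanMeasure E)} (hη : η ≠ 0) :
    ∃ R : ℝ, ∃ δ > 0, ∀ g : G, ‖(koopman α hα).toHom g η - η‖ < δ → ‖α g 0‖ ≤ R := by
  have hτ : 0 < ‖η‖ / 4 := by positivity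
  -- A translation part longer than `2 * R` separates the support of `φ` from its image, making
  -- $\pi(g)\eta'$ orthogonal to $\eta'$. Then $\eta'$ is moved by at least
  -- $\|\eta'\|\ge\frac34\|\eta\|$, against three errors of at most $\frac14\|\eta\|$, one of them
  -- strict.
  obtain ⟨φ, hφc, hφ, -, hφm⟩ := (Lp.memLp η).exists_hasCompactSupport_eLpNorm_sub_le
    (by norm_num) (ε := ENNReal.ofReal (‖η‖ / 4)) (by simpa using hη)
  obtain ⟨R, hR⟩ := hφc.isCompact.isBounded.subset_closedBall 0
  set η' : Lp ℂ 2 (euclideanMeasure E) := hφm.toLp φ with hη'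
  have hd : ‖η - η'‖ ≤ ‖η‖ / 4 := by
    have : η - η' = ((Lp.memLp η).sub hφm).toLp _ := by
      rw [MemLp.toLp_sub (Lp.memLp η) hφm, Lp.toLp_coeFn]
    rw [this, Lp.norm_toLp]
    exact ENNReal.toReal_le_of_le_ofReal hτ.le hφ
  refine ⟨2 * R, ‖η‖ / 4, hτ, fun g hg => ?_⟩
  by_contra! hlt
  set π := koopman α hα
  have hdisj : ∀ x, φ x = 0 ∨ φ (α g⁻¹ x) = 0 := by
    intro x
    by_contra! hcon
    have h1 : ‖x‖ ≤ R := by simpa using hR (subset_tsupport φ hcon.1)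
    have h2 : ‖α g⁻¹ x‖ ≤ R := by simpa using hR (subset_tsupport φ hcon.2)
    have h3 : dist x (α g 0) ≤ R := by
      rw [← (α g⁻¹).dist_eq, map_inv]
      simpa [map_inv] using h2
    have h4 := norm_le_norm_add_norm_sub' (α g 0) x
    rw [dist_eq_norm, norm_sub_rev] at h3
    linarith
  have horth : inner ℂ (π.toHom g η') η' = 0 := by
    rw [L2.inner_def]
    refine integral_eq_zero_of_ae ?_
    have e1 : (π.toHom g η' : E → ℂ) =ᵐ[euclideanMeasure E] φ ∘ α g⁻¹ :=
      (hφm.comp_measurePreserving (α g⁻¹).measurePreserving_euclideanMeasure).coeFn_toLp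
    filter_upwards [e1, hφm.coeFn_toLp] with x hx1 hx2
    rw [hx1, hη', hx2]
    rcases hdisj x with h | h <;> simp only [Function.comp_apply, h, inner_zero_left, inner_zero_right, Pi.zero_apply]
  have hsq : ‖η'‖ ≤ ‖π.toHom g η' - η'‖ := by
    have h := norm_sub_sq (𝕜 := ℂ) (π.toHom g η') η'
    rw [horth, LinearIsometryEquiv.norm_map] at h
    simp only [map_zero, mul_zero, sub_zero] at h
    refine (pow_le_pow_iff_left₀ (norm_nonneg _) (norm_nonneg _) two_ne_zero).1 ?_
    nlinarith [sq_nonneg ‖η'‖]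
  have h1 : ‖π.toHom g η' - η'‖ ≤ ‖η - η'‖ + ‖π.toHom g η - η‖ + ‖η - η'‖ := by
    have e : π.toHom g η' - η' = -(π.toHom g (η - η')) + (π.toHom g η - η) + (η - η') := by
      rw [map_sub]; abel
    rw [e]
    refine (norm_add₃_le).trans ?_
    rw [norm_neg, LinearIsometryEquiv.norm_map]
  have h2 := norm_le_norm_add_norm_sub' η η'
  linarith

end KoopmanRepresentation

/-! ### Asymptotic centres. -/

section AsymptoticCenter

/-- An action by isometries of a Hilbert space that is bounded along a filter compatible with the
group structure has a point that is asymptotically fixed along the filter. -/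
theorem exists_asymptotically_fixed {G E : Type*} [Group G] [NormedAddCommGroup E]
    [InnerProductSpace ℝ E] [CompleteSpace E] (α : G →* (E ≃ᵢ E)) (l : Filter G) [l.NeBot]
    (hmul : Tendsto (fun p : G × G => p.1 * p.2) (l ×ˢ l) l)
    {R : ℝ} (hR : ∀ᶠ g in l, ‖α g 0‖ ≤ R) :
    ∃ c : E, Tendsto (fun g => α g c) l (𝓝 c) := by
  -- `A x r` bounds by `r` the squared radius about `x` of the orbit of `0` along `l`. The desired
  -- point is the limit of points whose asymptotic radius tends to the infimum.
  let A : E → ℝ → Prop := fun x r => ∀ᶠ g in l, ‖α g 0 - x‖ ^ 2 ≤ r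
  let S : Set ℝ := {r | ∃ x, A x r}
  have hS0 : ∀ r ∈ S, 0 ≤ r := by
    rintro r ⟨x, hx⟩
    obtain ⟨g, hg⟩ := hx.exists
    exact (sq_nonneg _).trans hg
  have hSb : BddBelow S := ⟨0, hS0⟩
  have hSne : S.Nonempty := by
    refine ⟨R ^ 2, 0, hR.mono fun g hg => ?_⟩
    simpa using pow_le_pow_left₀ (norm_nonneg _) hg 2
  set m := sInf S
  -- By the parallelogram law, the midpoint of two distant near-minimizers would beat the infimum.
  have hconv : ∀ x y ε, A x (m + ε) → A y (m + ε) → dist x y ^ 2 ≤ 4 * ε := by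
    intro x y ε hx hy
    have : A ((1 / 2 : ℝ) • (x + y)) (m + ε - dist x y ^ 2 / 4) := by
      filter_upwards [hx, hy] with g h1 h2
      have h := parallelogram_law_with_norm ℝ (α g 0 - x) (α g 0 - y)
      have e1 : α g 0 - x + (α g 0 - y) = (2 : ℝ) • (α g 0 - (1 / 2 : ℝ) • (x + y)) := by
        module
      have e2 : α g 0 - x - (α g 0 - y) = y - x := by abel
      rw [e1, e2, norm_smul, mul_pow, norm_sub_rev y x, ← dist_eq_norm x y] at h
      rw [Real.norm_of_nonneg zero_le_two] at h
      linarith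
    have := csInf_le hSb ⟨_, this⟩
    linarith
  have hmove : ∀ x ε, A x (m + ε) → ∀ᶠ h in l, dist (α h x) x ^ 2 ≤ 4 * ε := by
    intro x ε hx
    -- For most `h`, the product `h * g` is good for most `g`; since
    -- $\|\alpha(hg)0-x\|=\|\alpha(g)0-\alpha(h)^{-1}x\|$, the point `α h⁻¹ x` is then a
    -- near-minimizer as well.
    filter_upwards [(hmul.eventually hx).curry] with h hh
    have : A (α h⁻¹ x) (m + ε) := hh.mono fun g hg => by
      rwa [← dist_eq_norm, ← (α h).dist_eq, ← IsometryEquiv.mul_apply, ← IsometryEquiv.mul_apply,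
        ← map_mul, ← map_mul, mul_inv_cancel, map_one, dist_eq_norm]
    have h2 := hconv _ _ _ hx this
    rwa [← (α h).dist_eq, ← IsometryEquiv.mul_apply, ← map_mul, mul_inv_cancel, map_one] at h2
  -- Excess $4^{-n}$ gives distances $2\cdot2^{-n}$, which are summable.
  have hex : ∀ n : ℕ, ∃ x, A x (m + (1 / 4) ^ n) := fun n => by
    obtain ⟨r, ⟨x, hx⟩, hr⟩ := exists_lt_of_csInf_lt hSne
      (lt_add_of_pos_right m (by positivity : (0 : ℝ) < (1 / 4) ^ n))
    exact ⟨x, hx.mono fun g hg => hg.trans hr.le⟩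
  choose x hx using hex
  have hpow : ∀ n : ℕ, 4 * (1 / 4 : ℝ) ^ n = (2 * (1 / 2) ^ n) ^ 2 := fun n => by
    rw [mul_pow, ← pow_mul, mul_comm n 2, pow_mul]
    norm_num
  have hsqrt : ∀ (t : ℝ) (n : ℕ), 0 ≤ t → t ^ 2 ≤ 4 * (1 / 4) ^ n → t ≤ 2 * (1 / 2) ^ n := by
    intro t n ht h
    rw [hpow] at h
    exact (pow_le_pow_iff_left₀ ht (by positivity) two_ne_zero).1 h
  have hstep : ∀ n, dist (x n) (x (n + 1)) ≤ 2 * (1 / 2) ^ n := fun n => by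
    refine hsqrt _ n dist_nonneg (hconv _ _ _ (hx n) ((hx (n + 1)).mono fun g hg => hg.trans ?_))
    have : (1 / 4 : ℝ) ^ (n + 1) ≤ (1 / 4) ^ n :=
      pow_le_pow_of_le_one (by norm_num) (by norm_num) n.le_succ
    linarith
  obtain ⟨c, hc⟩ := cauchySeq_tendsto_of_complete
    (cauchySeq_of_le_geometric (1 / 2) 2 (by norm_num) hstep)
  refine ⟨c, Metric.tendsto_nhds.2 fun ε hε => ?_⟩
  have hlim : Tendsto (fun n : ℕ => 2 * (1 / 2 : ℝ) ^ n) atTop (𝓝 0) := by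
    simpa using (tendsto_pow_atTop_nhds_zero_of_lt_one (by norm_num : (0 : ℝ) ≤ 1 / 2)
      (by norm_num)).const_mul 2
  obtain ⟨n, hn1, hn2⟩ := ((hlim.eventually_lt_const (by positivity : 0 < ε / 3)).and
    (hc.eventually (Metric.ball_mem_nhds c (by positivity : 0 < ε / 3)))).exists
  filter_upwards [hmove _ _ (hx n)] with h hh
  have h1 := hsqrt _ n dist_nonneg hh
  have h2 : dist (x n) c < ε / 3 := hn2
  have h3 := dist_triangle4 (α h c) (α h (x n)) (x n) c
  rw [(α h).dist_eq, dist_comm c] at h3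
  linarith

end AsymptoticCenter

/-! ### Extending an orbit of a Euclidean action to $Q$. -/

section Resolution

open UnitaryRep

variable {G Q : Type u} [Group G] [TopologicalSpace G] [IsTopologicalGroup G]
  [Group Q] [TopologicalSpace Q] [IsTopologicalGroup Q]

/-- For a resolution `f : G → Q`, every isometric action of `G` on a finite-dimensional Euclidean
space has a point whose orbit map extends continuously to `Q`. -/
theorem IsResolution.exists_orbit_extension {f : G →ₜ* Q} (hf : IsResolution f) {E : Type u}
    [NormedAddCommGroup E] [InnerProductSpace ℝ E] [FiniteDimensional ℝ E]
    (α : G →* (E ≃ᵢ E)) (hα : ∀ x : E, Continuous fun g => α g x) :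
    ∃ (x : E) (w : Q → E), Continuous w ∧ ∀ g, w (f g) = α g x := by
  let _ : MeasurableSpace E := borel E
  have : BorelSpace E := ⟨rfl⟩
  have : CompleteSpace E := FiniteDimensional.complete ℝ E
  -- Only a nonzero $Q$-vector is needed, so the empty compact set and $\varepsilon=1$ suffice.
  obtain ⟨η, hη0, -⟩ := hf.almost _ (koopman α hα) koopman_almostHasInvariantVectors ∅
    isCompact_empty 1 one_pos
  obtain ⟨w, hw⟩ := η.2
  obtain ⟨R, δ, hδ, hR⟩ := koopman_proper (α := α) (hα := hα) (η := η)
    fun h => hη0 (Subtype.ext h)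
  have hbd : ∀ᶠ g in comap f (𝓝 (1 : Q)), ‖α g 0‖ ≤ R := by
    have h1 : ∀ᶠ q in 𝓝 (1 : Q), dist (w q) η < δ := by
      have := hw.1.tendsto 1
      rw [hw.map_one] at this
      exact this.eventually (Metric.ball_mem_nhds _ hδ)
    filter_upwards [h1.comap f] with g hg
    rw [hw.2, dist_eq_norm] at hg
    exact hR g hg
  have hne : (comap f (𝓝 (1 : Q))).NeBot := comap_neBot fun s hs => ⟨1, by
    rw [map_one]
    exact mem_of_mem_nhds hs⟩
  have hmul : Tendsto (fun p : G × G => p.1 * p.2)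
      (comap f (𝓝 (1 : Q)) ×ˢ comap f (𝓝 (1 : Q))) (comap f (𝓝 1)) := by
    refine tendsto_comap_iff.2 ?_
    have h1 : Tendsto (fun p : G × G => f p.1 * f p.2)
        (comap f (𝓝 (1 : Q)) ×ˢ comap f (𝓝 (1 : Q))) (𝓝 (1 * 1)) :=
      (tendsto_comap.comp tendsto_fst).mul (tendsto_comap.comp tendsto_snd)
    rw [one_mul] at h1
    exact h1.congr fun p => (map_mul f p.1 p.2).symm
  obtain ⟨c, hc⟩ := exists_asymptotically_fixed α _ hmul hbd
  refine ⟨c, _root_.exists_orbit_extension f hf.dense (fun g => α g) (fun g h x => by simp)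
    (fun g => (α g).dist_eq) c fun ε hε => ?_⟩
  exact mem_comap.1 (hc (Metric.ball_mem_nhds c hε))

end Resolution

/-! ### Property $(\mathrm{FH}_{FD})$. -/

section FixedPoints

variable {G Q : Type u} [Group G] [TopologicalSpace G]
  [Group Q] [TopologicalSpace Q] [IsTopologicalGroup Q]

/-- The linear part of an isometry of a Euclidean space. -/
theorem IsometryEquiv.exists_linear_part {E : Type*} [NormedAddCommGroup E] [NormedSpace ℝ E]
    (e : E ≃ᵢ E) : ∃ L : E →ₗ[ℝ] E, ∀ x v, e (x + v) = e x + L v := by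
  -- Mazur–Ulam: a bijective isometry of real normed spaces is affine.
  refine ⟨e.toRealAffineIsometryEquiv.linearIsometryEquiv.toLinearEquiv.toLinearMap,
    fun x v => ?_⟩
  have := e.toRealAffineIsometryEquiv.map_vadd x v
  simp only [vadd_eq_add] at this
  rw [add_comm x, add_comm (e x)]
  exact this

/-- The directions `v` such that the orbit map of `x + v` extends along `f`, given that the one of
`x` does. -/
def orbitExtensionDirections (f : G →ₜ* Q) {E : Type*} [NormedAddCommGroup E] [NormedSpace ℝ E]
    (α : G →* (E ≃ᵢ E)) (x : E) : Submodule ℝ E where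
  carrier := {v | ∃ w : Q → E, Continuous w ∧ ∀ g, w (f g) = α g (x + v) - α g x}
  zero_mem' := ⟨fun _ => 0, continuous_const, fun g => by simp⟩
  add_mem' := by
    rintro u v ⟨w, hw, hw'⟩ ⟨z, hz, hz'⟩
    refine ⟨fun q => w q + z q, hw.add hz, fun g => ?_⟩
    obtain ⟨L, hL⟩ := (α g).exists_linear_part
    simp only [hw', hz', hL, map_add]
    abel
  smul_mem' := by
    rintro c v ⟨w, hw, hw'⟩
    refine ⟨fun q => c • w q, hw.const_smul c, fun g => ?_⟩
    obtain ⟨L, hL⟩ := (α g).exists_linear_part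
    simp [hw', hL]

/-- The points whose orbit maps extend form a nonempty affine subspace $x+F$. The extended orbit
maps stay in it and define an isometric action of $Q$, transported to $F$ with `x` as origin; a
point fixed by $Q$ is fixed by $G$ through `f`. -/
theorem PropertyFHFD.of_resolution [IsTopologicalGroup G] {f : G →ₜ* Q} (hf : IsResolution f)
    (h : PropertyFHFD Q) : PropertyFHFD G := by
  intro E _ _ _ α hα
  obtain ⟨x, w₀, hw₀, hw₀'⟩ := hf.exists_orbit_extension α hα
  set F := orbitExtensionDirections f α x
  have hW : ∀ v : F, ∃ w : Q → E, Continuous w ∧ ∀ g, w (f g) = α g (x + v) := by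
    rintro ⟨v, w, hw, hw'⟩
    exact ⟨fun q => w q + w₀ q, hw.add hw₀, fun g => by simp [hw', hw₀']⟩
  choose W hWc hW using hW
  have htr : ∀ v g q, W v (f g * q) = α g (W v q) := fun v g q =>
    congrFun (hf.dense.equalizer ((hWc v).comp (continuous_const_mul (f g)))
      ((α g).continuous.comp (hWc v)) (funext fun k => by
        simp only [Function.comp_apply]
        rw [← map_mul, hW, hW, map_mul]
        rfl)) q
  have hmem : ∀ v q, W v q - x ∈ F := fun v q =>
    ⟨fun q' => W v (q' * q) - w₀ q', ((hWc v).comp (continuous_mul_const q)).sub hw₀,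
      fun g => by simp [htr, hw₀']⟩
  let β : Q → F → F := fun q v => ⟨W v q - x, hmem v q⟩
  have hβ1 : ∀ v, β 1 v = v := fun v => Subtype.ext (by
    have := hW v 1
    simp only [map_one] at this
    simp [β, this])
  have hβmul : ∀ q q' v, β (q * q') v = β q (β q' v) := fun q q' v => by
    refine Subtype.ext (congrArg (· - x) ?_)
    exact congrFun (hf.dense.equalizer ((hWc v).comp (continuous_mul_const q'))
      (hWc (β q' v)) (funext fun g => by simp [htr, hW, β])) q
  have hβiso : ∀ q, Isometry (β q) := fun q => Isometry.of_dist_eq fun u v => by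
    have := congrFun (hf.dense.equalizer ((hWc u).dist (hWc v)) (continuous_const (y := dist u v))
      (funext fun g => by
        simp only [Function.comp_apply, hW, (α g).dist_eq, dist_add_left, Subtype.dist_eq])) q
    rw [← this, Subtype.dist_eq, dist_sub_right]
  let γ : Q →* (F ≃ᵢ F) :=
    { toFun := fun q => ⟨⟨β q, β q⁻¹, fun v => by rw [← hβmul, inv_mul_cancel, hβ1],
        fun v => by rw [← hβmul, mul_inv_cancel, hβ1]⟩, hβiso q⟩
      map_one' := IsometryEquiv.ext hβ1
      map_mul' := fun q q' => IsometryEquiv.ext (hβmul q q') }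
  obtain ⟨v, hv⟩ := h F γ fun v => ((hWc v).sub continuous_const).subtype_mk _
  refine ⟨x + v, fun g => ?_⟩
  have h1 : W v (f g) - x = v := congrArg Subtype.val (hv (f g))
  rw [← hW, ← h1]
  abel

omit [IsTopologicalGroup Q] in
theorem PropertyFHFD.of_dense {f : G →ₜ* Q} (hf : DenseRange f) (h : PropertyFHFD G) :
    PropertyFHFD Q := by
  intro E _ _ _ α hα
  obtain ⟨x, hx⟩ := h E (α.comp f.toMonoidHom) fun x => (hα x).comp f.continuous_toFun
  exact ⟨x, congrFun (hf.equalizer (hα x) continuous_const (funext hx))⟩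

end FixedPoints

/-! ### Cocycles of finite representations. -/

section FiniteRepresentations

variable {G : Type*} [Group G] [TopologicalSpace G]
  {H : Type*} [NormedAddCommGroup H] [InnerProductSpace ℂ H]

namespace UnitaryRep

/-- The restriction of a unitary representation to an invariant subspace. -/
def restrict (π : UnitaryRep G H) (W : Submodule ℂ H) (hW : ∀ g, ∀ ξ ∈ W, π.toHom g ξ ∈ W) :
    UnitaryRep G W where
  toHom :=
    { toFun := fun g =>
        { toFun := fun ξ => ⟨π.toHom g ξ, hW g ξ ξ.2⟩
          invFun := fun ξ => ⟨π.toHom g⁻¹ ξ, hW g⁻¹ ξ ξ.2⟩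
          map_add' := fun ξ η => Subtype.ext (map_add _ _ _)
          map_smul' := fun c ξ => Subtype.ext (map_smul _ _ _)
          left_inv := fun ξ => Subtype.ext (by simp)
          right_inv := fun ξ => Subtype.ext (by simp)
          norm_map' := fun ξ => (π.toHom g).norm_map ξ }
      map_one' := LinearIsometryEquiv.ext fun ξ => Subtype.ext (by simp)
      map_mul' := fun g h => LinearIsometryEquiv.ext fun ξ => Subtype.ext (by simp) }
  continuous_orbit ξ := (π.continuous_orbit ξ).subtype_mk _

@[simp] theorem restrict_apply_coe (π : UnitaryRep G H) (W : Submodule ℂ H)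
    (hW : ∀ g, ∀ ξ ∈ W, π.toHom g ξ ∈ W) (g : G) (ξ : W) :
    (((π.restrict W hW).toHom g ξ : W) : H) = π.toHom g ξ := rfl

theorem IsFinite.restrict {π : UnitaryRep G H} (h : π.IsFinite) (W : Submodule ℂ H)
    (hW : ∀ g, ∀ ξ ∈ W, π.toHom g ξ ∈ W) : (π.restrict W hW).IsFinite := by
  have : π.toHom.ker.FiniteIndex := h
  refine Subgroup.finiteIndex_of_le (H := π.toHom.ker) fun g hg => ?_
  refine MonoidHom.mem_ker.2 (LinearIsometryEquiv.ext fun ξ => Subtype.ext ?_)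
  rw [restrict_apply_coe, MonoidHom.mem_ker.1 hg]
  rfl

/-- The orthogonal complement of an invariant subspace is invariant by unitarity. Hence projecting a
cocycle to `W` yields a cocycle of the restriction. -/
theorem orthogonalProjectionOnto_map (π : UnitaryRep G H) (W : Submodule ℂ H)
    [W.HasOrthogonalProjection] (hW : ∀ g, ∀ ξ ∈ W, π.toHom g ξ ∈ W) (g : G) (ξ : H) :
    W.orthogonalProjectionOnto (π.toHom g ξ) =
      (π.restrict W hW).toHom g (W.orthogonalProjectionOnto ξ) := by
  refine Subtype.ext (Submodule.eq_starProjection_of_mem_of_inner_eq_zero (Subtype.coe_prop _)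
    fun w hw => ?_)
  have h1 : π.toHom g (π.toHom g⁻¹ w) = w := by simp
  rw [restrict_apply_coe, ← map_sub, ← h1, LinearIsometryEquiv.inner_map_map]
  exact Submodule.starProjection_inner_eq_zero ξ _ (hW g⁻¹ w hw)

/-- A cocycle of a finite representation that vanishes on its kernel is a coboundary. -/
theorem IsFinite.exists_eq_coboundary {π : UnitaryRep G H} (h : π.IsFinite) {b : G → H}
    (hb : ∀ g k, b (g * k) = b g + π.toHom g (b k)) (h0 : ∀ n ∈ π.toHom.ker, b n = 0) :
    ∃ v, ∀ g, b g = π.toHom g v - v := by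
  have : π.toHom.ker.FiniteIndex := h
  set N := π.toHom.ker
  let _ : Fintype (G ⧸ N) := Fintype.ofFinite _
  have hdesc : ∀ g : G, b ((g : G ⧸ N).out) = b g := fun g => by
    obtain ⟨n, hn⟩ := QuotientGroup.mk_out_eq_mul N g
    rw [hn, hb, h0 n n.2, map_zero, add_zero]
  -- `b` descends to the finite quotient; summing the cocycle identity over it gives
  -- $S=|G/N|\,b(g)+\pi(g)S$.
  set S : H := ∑ c : G ⧸ N, b c.out
  have hS : ∀ g, S = (Fintype.card (G ⧸ N) : ℂ) • b g + π.toHom g S := fun g => by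
    have h1 : S = ∑ c : G ⧸ N, b (g • c).out :=
      (Equiv.sum_comp (MulAction.toPerm g) fun c : G ⧸ N => b c.out).symm
    have h2 : ∀ c : G ⧸ N, b (g • c).out = b g + π.toHom g (b c.out) := fun c => by
      rw [← hb, ← hdesc (g * c.out)]
      congr 2
      conv_lhs => rw [← QuotientGroup.out_eq' c]
      rfl
    refine h1.trans ?_
    rw [Finset.sum_congr rfl fun c _ => h2 c, Finset.sum_add_distrib, map_sum]
    simp [Nat.cast_smul_eq_nsmul]
  have hn : (Fintype.card (G ⧸ N) : ℂ) ≠ 0 := Nat.cast_ne_zero.2 Fintype.card_ne_zero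
  refine ⟨-((Fintype.card (G ⧸ N) : ℂ)⁻¹ • S), fun g => ?_⟩
  have h3 : S - π.toHom g S = (Fintype.card (G ⧸ N) : ℂ) • b g :=
    sub_eq_of_eq_add (hS g)
  rw [map_neg, map_smul, neg_sub_neg, ← smul_sub, h3, inv_smul_smul₀ hn]

/-- For finite representations, vanishing of `H¹` can be tested on finite-dimensional
subrepresentations. -/
theorem IsFinite.hasVanishingH1 {π : UnitaryRep G H} (h : π.IsFinite)
    (hfd : ∀ (W : Submodule ℂ H) (hW : ∀ g, ∀ ξ ∈ W, π.toHom g ξ ∈ W),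
      FiniteDimensional ℂ W → (π.restrict W hW).HasVanishingH1) : π.HasVanishingH1 := by
  intro b hbc hb
  refine h.exists_eq_coboundary hb fun n hn => ?_
  have hfin : π.toHom.ker.FiniteIndex := h
  -- The span of a finite orbit. The projection of `b` to `W` is a coboundary, hence vanishes at
  -- `n`, which acts trivially; but it fixes `b n`.
  set W := Submodule.span ℂ (Set.range fun g => π.toHom g (b n))
  have hWinv : ∀ g, ∀ ξ ∈ W, π.toHom g ξ ∈ W := by
    intro g ξ hξ
    have hle : W ≤ W.comap (π.toHom g).toLinearEquiv.toLinearMap := Submodule.span_le.2 <| by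
      rintro _ ⟨k, rfl⟩
      refine Submodule.subset_span ⟨g * k, ?_⟩
      simp
    exact hle hξ
  have hrange : (Set.range fun g => π.toHom g (b n)).Finite := by
    have h1 : (Set.range π.toHom).Finite :=
      Set.finite_coe_iff.1 (Finite.of_equiv _ (QuotientGroup.quotientKerEquivRange π.toHom).toEquiv)
    have : (Set.range fun g => π.toHom g (b n)) = (fun e : H ≃ₗᵢ[ℂ] H => e (b n)) ''
        Set.range π.toHom := by
      rw [← Set.range_comp]
      rfl
    rw [this]
    exact h1.image _
  have : FiniteDimensional ℂ W := FiniteDimensional.span_of_finite ℂ hrange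
  obtain ⟨v, hv⟩ := hfd W hWinv this (fun g => W.orthogonalProjectionOnto (b g))
    (W.orthogonalProjectionOnto.continuous.comp hbc) fun g k => by
      rw [hb, map_add, orthogonalProjectionOnto_map π W hWinv]
  have hbW : b n ∈ W := Submodule.subset_span ⟨1, by simp⟩
  have h1 := hv n
  have h2 : (π.restrict W hWinv).toHom n v = v := Subtype.ext (by
    rw [restrict_apply_coe, MonoidHom.mem_ker.1 hn]
    rfl)
  rw [h2, sub_self] at h1
  have h3 := Submodule.orthogonalProjectionOnto_mem_subspace_eq_self (⟨b n, hbW⟩ : W)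
  rw [h1] at h3
  exact congrArg Subtype.val h3.symm

end UnitaryRep

end FiniteRepresentations

/-! ### Property $(\mathrm{FH}_F)$. -/

section Cohomology

variable {G Q : Type u} [Group G] [TopologicalSpace G] [IsTopologicalGroup G]
  [Group Q] [TopologicalSpace Q] [IsTopologicalGroup Q]

/-- Moving the origin of the affine action $\pi(g)x+b(g)$ to a point whose orbit extends replaces
`b` by a cohomologous cocycle that extends to $Q$. The extension takes values in the $Q$-vectors, so
it is a cocycle of $\pi^Q$. -/
theorem IsResolution.hasVanishingH1 {f : G →ₜ* Q} (hf : IsResolution f) {W : Type u}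
    [NormedAddCommGroup W] [InnerProductSpace ℂ W] [FiniteDimensional ℂ W] {π : UnitaryRep G W}
    (h : (π.qRep f hf.dense).HasVanishingH1) : π.HasVanishingH1 := by
  intro b hbc hb
  have : CompleteSpace W := FiniteDimensional.complete ℂ W
  let _ : InnerProductSpace ℝ W := InnerProductSpace.complexToReal
  have : FiniteDimensional ℝ W := FiniteDimensional.complexToReal W
  let α : G →* (W ≃ᵢ W) :=
    { toFun := fun g => (π.toHom g).toIsometryEquiv.trans (IsometryEquiv.addRight (b g))
      map_one' := by
        have h1 := hb 1 1
        simp only [mul_one, map_one, LinearIsometryEquiv.coe_one, id_eq, left_eq_add] at h1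
        ext x
        simp [h1]
      map_mul' := fun g k => by
        ext x
        simp [hb, add_comm, add_left_comm] }
  have hα : ∀ g x, α g x = π.toHom g x + b g := fun g x => rfl
  obtain ⟨x, w, hw, hwf⟩ := hf.exists_orbit_extension α fun x => (π.continuous_orbit x).add hbc
  set B : Q → W := fun q => w q - x
  have hBc : Continuous B := hw.sub continuous_const
  have hBf : ∀ g, B (f g) = π.toHom g x - x + b g := fun g => by
    simp only [B, hwf, hα]
    abel
  have hBcoc : ∀ g q, B (f g * q) = B (f g) + π.toHom g (B q) := fun g q =>
    congrFun (hf.dense.equalizer (g := fun q => B (f g * q))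
      (h := fun q => B (f g) + π.toHom g (B q)) (hBc.comp (continuous_const_mul (f g)))
      (continuous_const.add ((π.toHom g).continuous.comp hBc)) (funext fun k => by
        simp only [Function.comp_apply]
        rw [← map_mul, hBf, hBf, hBf, hb, map_mul, map_add, map_sub]
        simp only [LinearIsometryEquiv.coe_mul, Function.comp_apply]
        abel)) q
  -- By the cocycle identity, $q'\mapsto B(q'q)-B(q')$ extends the orbit map of $B(q)$.
  have hmem : ∀ q, B q ∈ qVectors f π := fun q =>
    ⟨fun q' => B (q' * q) - B q', (hBc.comp (continuous_mul_const q)).sub hBc, fun g => by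
      simp [hBcoc]⟩
  have hcoc : ∀ q q', (⟨B (q * q'), hmem _⟩ : qVectors f π) =
      ⟨B q, hmem q⟩ + (π.qRep f hf.dense).toHom q ⟨B q', hmem q'⟩ := fun q q' =>
    congrFun (hf.dense.equalizer
      (g := fun q => (⟨B (q * q'), hmem _⟩ : qVectors f π))
      (h := fun q => ⟨B q, hmem q⟩ + (π.qRep f hf.dense).toHom q ⟨B q', hmem q'⟩)
      ((hBc.comp (continuous_mul_const q')).subtype_mk _)
      ((hBc.subtype_mk _).add ((π.qRep f hf.dense).continuous_orbit _)) (funext fun g => by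
        refine Subtype.ext ((hBcoc g q').trans ?_)
        rw [Function.comp_apply, Submodule.coe_add, qRep_map_coe])) q
  obtain ⟨v, hv⟩ := h (fun q => ⟨B q, hmem q⟩) (hBc.subtype_mk _) hcoc
  refine ⟨v - x, fun g => ?_⟩
  have h1 := congrArg Subtype.val (hv (f g))
  rw [Submodule.coe_sub, qRep_map_coe] at h1
  simp only [hBf] at h1
  rw [map_sub, eq_sub_of_add_eq' h1]
  abel

theorem IsResolution.propertyFHF_iff {f : G →ₜ* Q} (hf : IsResolution f) :
    PropertyFHF G ↔ PropertyFHF Q := by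
  constructor
  · intro h H _ _ _ ρ hρ
    exact (h H (ρ.pullback f) (hρ.pullback f)).of_pullback hf.dense
  · intro h H _ _ _ π hπ
    refine hπ.hasVanishingH1 fun W hW _ => hf.hasVanishingH1 ?_
    have : CompleteSpace (qVectors f (π.restrict W hW)) := FiniteDimensional.complete ℂ _
    exact h _ _ ((hπ.restrict W hW).qRep hf.dense)

end Cohomology

/-! ### Homomorphisms on finite index subgroups: (FAb) and $(\mathrm{FAb}^{\mathbf R})$. -/

section FiniteIndexHoms

variable {G Q : Type u} [Group G] [TopologicalSpace G] [IsTopologicalGroup G]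
  [Group Q] [TopologicalSpace Q] [IsTopologicalGroup Q]

/-- A function that transforms under right translation by an open subgroup through a continuous
homomorphism is continuous. -/
theorem continuous_of_mul_right {H : Subgroup G} (hH : IsOpen (H : Set G)) {φ : H → ℝ}
    (hφ : Continuous φ) {ψ : G → ℝ} (hψ : ∀ x (h : H), ψ (x * h) = ψ x + φ h) :
    Continuous ψ := by
  refine continuous_iff_continuousAt.2 fun x => ?_
  have he : IsOpenEmbedding fun h : H => x * (h : G) :=
    (Homeomorph.mulLeft x).isOpenEmbedding.comp hH.isOpenEmbedding_subtypeVal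
  have h1 : ContinuousAt (ψ ∘ fun h : H => x * (h : G)) 1 := by
    have : (ψ ∘ fun h : H => x * (h : G)) = fun h => ψ x + φ h := funext (hψ x)
    rw [this]
    exact (continuous_const.add hφ).continuousAt
  have := (he.continuousAt_iff (g := ψ)).1 h1
  simpa using this

/-- The isometric action of `G` on a finite-dimensional Euclidean space induced from the action
by translations of a finite index subgroup. -/
theorem exists_induced_action {H : Subgroup G} (hcl : IsClosed (H : Set G)) [H.FiniteIndex]
    (φ : H →ₜ* Multiplicative ℝ) :
    ∃ (E : Type u) (_ : NormedAddCommGroup E) (_ : InnerProductSpace ℝ E)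
      (_ : FiniteDimensional ℝ E) (α : G →* (E ≃ᵢ E)) (ev : E → ℝ),
      (∀ x, Continuous fun g => α g x) ∧ Continuous ev ∧
        ∀ v (h : H), ev (α (h : G)⁻¹ v) = ev v + (φ h).toAdd := by
  have hop : IsOpen (H : Set G) := H.isOpen_of_isClosed_of_finiteIndex hcl
  let _ : Fintype (G ⧸ H) := Fintype.ofFinite _
  let φ' : H → ℝ := fun h => (φ h).toAdd
  have hφ' : Continuous φ' := continuous_toAdd.comp φ.continuous_toFun
  have hφmul : ∀ h k, φ' (h * k) = φ' h + φ' k := fun h k => by simp [φ']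
  have hout : ∀ x : G, ((x : G ⧸ H).out)⁻¹ * x ∈ H := fun x =>
    QuotientGroup.eq.1 (QuotientGroup.out_eq' (x : G ⧸ H))
  let E := EuclideanSpace ℝ (G ⧸ H)
  -- Coset representatives identify `E` with the functions on $G$ satisfying
  -- $F(xh)=F(x)+\varphi(h)$. On these $G$ acts by left translation, isometrically because
  -- differences are functions on $G/H$; evaluation at `1` recovers $\varphi$.
  let F : E → G → ℝ := fun v x => v (x : G ⧸ H) + φ' ⟨_, hout x⟩
  have hF : ∀ v x (h : H), F v (x * h) = F v x + φ' h := fun v x h => by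
    have h1 : ((x * h : G) : G ⧸ H) = x := QuotientGroup.eq.2 (by simp)
    have h2 : (⟨_, hout (x * h)⟩ : H) = ⟨_, hout x⟩ * h := Subtype.ext (by
      simp only [h1, Subgroup.coe_mul, mul_assoc])
    change v ((x * h : G) : G ⧸ H) + φ' _ = v (x : G ⧸ H) + φ' _ + φ' h
    rw [h2, h1, hφmul, add_assoc]
  have hFc : ∀ v, Continuous (F v) := fun v => continuous_of_mul_right hop hφ' (hF v)
  have hFeq : ∀ u v x, F u x - F v x = u (x : G ⧸ H) - v (x : G ⧸ H) := fun u v x => by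
    simp only [F]
    ring
  have hF1 : φ' 1 = 0 := by simp [φ']
  have hFout : ∀ v (c : G ⧸ H), F v c.out = v c := fun v c => by
    have : (⟨_, hout c.out⟩ : H) = 1 := Subtype.ext (by simp)
    simp only [F]
    rw [this, hF1, add_zero, QuotientGroup.out_eq']
  let a : G → E → E := fun g v => WithLp.toLp 2 fun c => F v (g⁻¹ * c.out)
  have ha : ∀ g v (c : G ⧸ H), a g v c = F v (g⁻¹ * c.out) := fun g v c => rfl
  have hFa : ∀ g v x, F (a g v) x = F v (g⁻¹ * x) := fun g v x => by
    have h1 : x = (x : G ⧸ H).out * ((⟨_, hout x⟩ : H) : G) := by simp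
    conv_rhs => rw [h1, ← mul_assoc, hF]
  have ha1 : ∀ v, a 1 v = v := fun v => by
    ext c
    rw [ha, inv_one, one_mul, hFout]
  have hamul : ∀ g k v, a (g * k) v = a g (a k v) := fun g k v => by
    ext c
    rw [ha, ha, hFa, mul_inv_rev, mul_assoc]
  have hiso : ∀ g, Isometry (a g) := fun g => Isometry.of_dist_eq fun u v => by
    rw [EuclideanSpace.dist_eq, EuclideanSpace.dist_eq]
    congr 1
    rw [← Equiv.sum_comp (MulAction.toPerm g⁻¹) fun c : G ⧸ H => dist (u c) (v c) ^ 2]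
    refine Finset.sum_congr rfl fun c _ => ?_
    have : ((g⁻¹ * c.out : G) : G ⧸ H) = g⁻¹ • c := by
      conv_rhs => rw [← QuotientGroup.out_eq' c]
      rfl
    rw [ha, ha, Real.dist_eq, hFeq, this, ← Real.dist_eq]
    rfl
  refine ⟨E, inferInstance, inferInstance, inferInstance,
    { toFun := fun g => ⟨⟨a g, a g⁻¹, fun v => by rw [← hamul, inv_mul_cancel, ha1],
        fun v => by rw [← hamul, mul_inv_cancel, ha1]⟩, hiso g⟩
      map_one' := IsometryEquiv.ext ha1
      map_mul' := fun g k => IsometryEquiv.ext (hamul g k) }, fun v => F v 1, fun v => ?_, ?_,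
    fun v h => ?_⟩
  · refine (PiLp.continuous_toLp 2 _).comp (continuous_pi fun c => ?_)
    exact (hFc v).comp (continuous_inv.mul continuous_const)
  · exact (PiLp.continuous_apply 2 _ _).add continuous_const
  · refine (hFa _ v 1).trans ?_
    have := hF v 1 h
    rw [one_mul] at this
    rwa [inv_inv, mul_one]

/-- In the induced action, $\varphi$ is read off from the orbit of any point. Taking an orbit that
extends to $Q$ extends $\varphi$ to a continuous function, additive on the closure of $f(H)$ by
density. -/
theorem IsResolution.exists_hom_extension {f : G →ₜ* Q} (hf : IsResolution f) {H : Subgroup G}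
    (hcl : IsClosed (H : Set G)) [H.FiniteIndex] (φ : H →ₜ* Multiplicative ℝ) :
    ∃ Φ : (H.map f.toMonoidHom).topologicalClosure →ₜ* Multiplicative ℝ, ∀ h : H,
      Φ ⟨f h, Subgroup.le_topologicalClosure _ (Subgroup.mem_map_of_mem f.toMonoidHom h.2)⟩
        = φ h := by
  obtain ⟨E, _, _, _, α, ev, hα, hev, hαφ⟩ := exists_induced_action hcl φ
  obtain ⟨v, w, hw, hwf⟩ := hf.exists_orbit_extension α hα
  set S := (H.map f.toMonoidHom).topologicalClosure
  let Φ : Q → ℝ := fun q => ev (w q⁻¹) - ev v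
  have hΦ : Continuous Φ := (hev.comp (hw.comp continuous_inv)).sub continuous_const
  have hΦf : ∀ h : H, Φ (f h) = (φ h).toAdd := fun h => by
    simp only [Φ]
    rw [← map_inv, hwf, hαφ, add_sub_cancel_left]
  have hind : ∀ p : Q → Prop, IsClosed {q | p q} → (∀ h : H, p (f h)) → ∀ s ∈ S, p s := by
    intro p hp hpf s hs
    refine hp.closure_subset_iff.2 ?_ hs
    rintro _ ⟨h, hh, rfl⟩
    exact hpf ⟨h, hh⟩
  have hmul : ∀ s ∈ S, ∀ t ∈ S, Φ (s * t) = Φ s + Φ t := by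
    intro s hs
    refine hind _ (isClosed_eq (hΦ.comp (continuous_const_mul s)) (continuous_const.add hΦ))
      fun k => ?_
    refine hind (fun s => Φ (s * f k) = Φ s + Φ (f k))
      (isClosed_eq (hΦ.comp (continuous_mul_const _)) (hΦ.add continuous_const))
      (fun h => ?_) s hs
    rw [hΦf, hΦf, ← map_mul, ← Subgroup.coe_mul, hΦf, map_mul, toAdd_mul]
  have h1 : Φ 1 = 0 := by
    have := hmul 1 S.one_mem 1 S.one_mem
    rw [one_mul] at this
    linarith
  exact ⟨{ toFun := fun s => Multiplicative.ofAdd (Φ s)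
           map_one' := congrArg Multiplicative.ofAdd h1
           map_mul' := fun s t => congrArg Multiplicative.ofAdd (hmul s s.2 t t.2)
           continuous_toFun := continuous_ofAdd.comp (hΦ.comp continuous_subtype_val) },
    fun h => congrArg Multiplicative.ofAdd (hΦf h)⟩

theorem PropertyFAbReal.of_resolution {f : G →ₜ* Q} (hf : IsResolution f)
    (h : PropertyFAbReal Q) : PropertyFAbReal G := by
  intro H hcl _ φ x
  obtain ⟨Φ, hΦ⟩ := hf.exists_hom_extension hcl φ
  rw [← hΦ]
  exact h _ (Subgroup.isClosed_topologicalClosure _)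
    (finiteIndex_topologicalClosure_map f hf.dense H) Φ _

/-- As $\mathbf Z$ is closed in $\mathbf R$, the real-valued extension of an integer-valued
homomorphism stays integer-valued on the closure of $f(H)$. -/
theorem PropertyFAb.of_resolution {f : G →ₜ* Q} (hf : IsResolution f)
    (h : PropertyFAb Q) : PropertyFAb G := by
  intro H hcl _ φ x
  let φ' : H →ₜ* Multiplicative ℝ :=
    { (Int.castAddHom ℝ).toMultiplicative.comp φ.toMonoidHom with
      continuous_toFun := continuous_ofAdd.comp (continuous_of_discreteTopology.comp
        (continuous_toAdd.comp φ.continuous_toFun)) }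
  obtain ⟨Φ, hΦ⟩ := hf.exists_hom_extension hcl φ'
  let S := (H.map f.toMonoidHom).topologicalClosure
  have hΦc : Continuous fun s => (Φ s).toAdd := continuous_toAdd.comp Φ.continuous_toFun
  have hdense : DenseRange fun h : H => (⟨f h, Subgroup.le_topologicalClosure _
      (Subgroup.mem_map_of_mem f.toMonoidHom h.2)⟩ : S) := by
    intro s
    rw [closure_subtype]
    refine closure_mono ?_ s.2
    rintro _ ⟨h, hh, rfl⟩
    exact ⟨_, ⟨⟨h, hh⟩, rfl⟩, rfl⟩
  have hint : ∀ s, (Φ s).toAdd ∈ Set.range ((↑) : ℤ → ℝ) := fun s => by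
    have hc : IsClosed {s | (Φ s).toAdd ∈ Set.range ((↑) : ℤ → ℝ)} :=
      Int.isClosedEmbedding_coe_real.isClosed_range.preimage hΦc
    refine hc.closure_subset_iff.2 ?_ (hdense s)
    rintro _ ⟨h, rfl⟩
    exact ⟨(φ h).toAdd, congrArg Multiplicative.toAdd (hΦ h).symm⟩
  choose Ψ hΨ using hint
  have hΨc : Continuous Ψ := by
    refine Int.isClosedEmbedding_coe_real.continuous_iff.2 ?_
    exact hΦc.congr fun s => (hΨ s).symm
  let Ψ' : S →ₜ* Multiplicative ℤ :=
    { toFun := fun s => Multiplicative.ofAdd (Ψ s)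
      map_one' := congrArg Multiplicative.ofAdd (Int.cast_injective (α := ℝ) (by
        rw [hΨ, Int.cast_zero]
        exact congrArg Multiplicative.toAdd (map_one Φ)))
      map_mul' := fun s t => congrArg Multiplicative.ofAdd
        (Int.cast_injective (α := ℝ) (by
          rw [hΨ, Int.cast_add, toAdd_ofAdd, toAdd_ofAdd, hΨ, hΨ]
          exact congrArg Multiplicative.toAdd (map_mul Φ s t)))
      continuous_toFun := continuous_ofAdd.comp hΨc }
  have h1 := h S (Subgroup.isClosed_topologicalClosure _)
    (finiteIndex_topologicalClosure_map f hf.dense H) Ψ'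
    ⟨f x, Subgroup.le_topologicalClosure _ (Subgroup.mem_map_of_mem f.toMonoidHom x.2)⟩
  have h2 : Ψ ⟨f x, Subgroup.le_topologicalClosure _
    (Subgroup.mem_map_of_mem f.toMonoidHom x.2)⟩ = 0 := congrArg Multiplicative.toAdd h1
  have h3 := congrArg Multiplicative.toAdd (hΦ x)
  rw [← hΨ, h2, Int.cast_zero] at h3
  have h4 : (((φ x).toAdd : ℤ) : ℝ) = 0 := h3.symm
  exact congrArg Multiplicative.ofAdd (Int.cast_eq_zero.1 h4)

omit [IsTopologicalGroup G] in
/-- A homomorphism on a closed finite index subgroup of `Q` is trivial if its pullback along a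
homomorphism with dense image is. -/
theorem hom_eq_one_of_comap {f : G →ₜ* Q} (hf : DenseRange f) {A : Type*} [Monoid A]
    [TopologicalSpace A] [T2Space A]
    (hG : ∀ H : Subgroup G, IsClosed (H : Set G) → H.FiniteIndex →
      ∀ φ : H →ₜ* A, ∀ h : H, φ h = 1)
    (H : Subgroup Q) (hcl : IsClosed (H : Set Q)) (hfin : H.FiniteIndex)
    (φ : H →ₜ* A) (x : H) : φ x = 1 := by
  have hop : IsOpen (H : Set Q) := H.isOpen_of_isClosed_of_finiteIndex hcl
  let H' : Subgroup G := H.comap f.toMonoidHom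
  let ψ : H' →ₜ* A :=
    { φ.toMonoidHom.comp (f.toMonoidHom.subgroupComap H) with
      continuous_toFun := φ.continuous_toFun.comp
        ((f.continuous_toFun.comp continuous_subtype_val).subtype_mk _) }
  have hψ := hG H' (hcl.preimage f.continuous_toFun) (finiteIndex_comap _ _) ψ
  have hC : IsClosed (((↑) : H → Q) '' {x | φ x = 1}) :=
    hcl.isClosedEmbedding_subtypeVal.isClosedMap _
      (isClosed_eq φ.continuous_toFun continuous_const)
  -- Openness of `H` is essential: it makes $H\cap f(G)$ dense in `H`.
  have hx : (x : Q) ∈ closure ((H : Set Q) ∩ Set.range f) :=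
    hop.inter_closure ⟨x.2, hf x⟩
  have hsub : (H : Set Q) ∩ Set.range f ⊆ ((↑) : H → Q) '' {x | φ x = 1} := by
    rintro _ ⟨hq, g, rfl⟩
    exact ⟨⟨f g, hq⟩, hψ ⟨g, hq⟩, rfl⟩
  obtain ⟨y, hy, hyx⟩ := hC.closure_subset_iff.2 hsub hx
  rwa [← Subtype.ext hyx]

end FiniteIndexHoms

theorem mainTheorem10 {G Q : Type u}
    [Group G] [TopologicalSpace G] [IsTopologicalGroup G] [LocallyCompactSpace G] [T2Space G]
    [Group Q] [TopologicalSpace Q] [IsTopologicalGroup Q] [LocallyCompactSpace Q] [T2Space Q]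
    (f : G →ₜ* Q) (hf : IsResolution f) :
    (PropertyT G ↔ PropertyT Q) ∧
    (PropertyTau G ↔ PropertyTau Q) ∧
    (PropertyTauFD G ↔ PropertyTauFD Q) ∧
    (PropertyFAb G ↔ PropertyFAb Q) ∧
    (PropertyFAbReal G ↔ PropertyFAbReal Q) ∧
    (PropertyFHF G ↔ PropertyFHF Q) ∧
    (PropertyFHFD G ↔ PropertyFHFD Q) :=
  ⟨hf.propertyT_iff, hf.propertyTau_iff, hf.propertyTauFD_iff,
    ⟨fun h => hom_eq_one_of_comap hf.dense h, .of_resolution hf⟩,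
    ⟨fun h => hom_eq_one_of_comap hf.dense h, .of_resolution hf⟩,
    hf.propertyFHF_iff, ⟨.of_dense hf.dense, .of_resolution hf⟩⟩
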